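/- **Setting.** For $m$ candidates, a ranking is a linear order on the candidates, and a voting profile is a list of rankings, one per voter. A positional scoring rule $r$ assigns to every $m$ a vector $\vec s_m(1)\ge\dots\ge \vec s_m(m)$ of natural numbers (strictness $\vec s_m(1)>\vec s_m(m)$ is not required); it is *binary* if all entries are $0$ or $1$. A voter contributes $\vec s_m(j)$ to the candidate that she ranks in position $j$; the score of a candidate in a profile is the sum of the contributions of the voters, and $c$ is a winner if no candidate has a larger score. The rule $k$-approval gives $1$ to the top $k$ positions and $0$ to the others; $k$-veto gives $0$ to the bottom $k$ positions and $1$ to the others. In the problem CCAUV under $r$ (constructive control by adding an unlimited number of voters), the input consists of the candidates, a profile $\mathbf M$ of registered voters, a profile $\mathbf Q$ of unregistered voters, and a candidate $c$; the question is whether there is a sublist $\mathbf Q'$ of $\mathbf Q$ such that $c$ is a winner of the concatenation $\mathbf M\circ\mathbf Q'$. In the probabilistic setting, the input consists of a profile $\mathbf T=(T_1,\dots,T_n)$, rational probabilities $p_1,\dots,p_n\in[0,1]$ (in binary) and a candidate $c$; every voter $i$ participates independently with probability $p_i$, and $\Pr[\mathrm{win}(c,\mathbf T')]$ is the probability that $c$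 is a winner of the random profile $\mathbf T'$ of the participating voters. **Theorem.** 1. Let $r$ be a binary positional scoring rule such that $(m,j)\mapsto \vec s_m(j)$ is computable in time polynomial in $m$. Then CCAUV under $r$ is decidable in polynomial time, and so is the question whether $\Pr[\mathrm{win}(c,\mathbf T')]>0$ under $r$. 2. For every fixed $k$, this applies to $k$-approval and to $k$-veto: they are binary positional scoring rules whose scores are computable in time polynomial in $m$. 3. Let $r$ be a binary positional scoring rule, let $\mathbf M$ and $\mathbf Q$ be profiles and $c$ a candidate, and let $\mathbf Q^*$ be the sublist of all voters in $\mathbf Q$ who contribute $1$ to $c$. Then there is a sublist $\mathbf Q'$ of $\mathbf Q$ such that $c$ is a winner of $\mathbf M\circ\mathbf Q'$ if and only if $c$ is a winner of $\mathbf M\circ\mathbf Q^*$. -/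

import Mathlib

/-! ### Positional scoring rules -/

/-- A positional scoring rule: for every number `m` of candidates a nonincreasing vector of `m`
natural numbers; `score m j` is the score of position `j` (position `0` is the top).
The customary condition that the first entry exceeds the last one is not imposed: no vector of
length one satisfies it, `k`-approval violates it for `m ≤ k`, and nothing below needs it. -/
structure PositionalScoringRule where
  score : (m : ℕ) → Fin m → ℕ
  antitone : ∀ m, Antitone (score m)

/-- A ranking (linear order) of the candidates `Fin m`, listed from best to worst:
`v j` is the candidate in position `j`, so `v.symm c` is the position of candidate `c`. -/
abbrev Ranking (m : ℕ) : Type := Equiv.Perm (Fin m)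

/-- A voting profile: the list of the voters' rankings. -/
abbrev Profile (m : ℕ) : Type := List (Ranking m)

namespace PositionalScoringRule

/-- The score that a voter with ranking `v` contributes to candidate `c`. -/
def contribution (r : PositionalScoringRule) {m : ℕ} (v : Ranking m) (c : Fin m) : ℕ :=
  r.score m (v.symm c)

/-- The total score of candidate `c` in the profile `T`. -/
def totalScore (r : PositionalScoringRule) {m : ℕ} (T : Profile m) (c : Fin m) : ℕ :=
  (T.map fun v => r.contribution v c).sum

/-- Candidate `c` is a winner (co-winner) of the profile `T`. -/
def IsWinner (r : PositionalScoringRule) {m : ℕ} (T : Profile m) (c : Fin m) : Prop :=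
  ∀ c' : Fin m, r.totalScore T c' ≤ r.totalScore T c

instance (r : PositionalScoringRule) {m : ℕ} (T : Profile m) (c : Fin m) :
    Decidable (r.IsWinner T c) :=
  inferInstanceAs (Decidable (∀ c' : Fin m, r.totalScore T c' ≤ r.totalScore T c))

/-- A binary rule: every score is `0` or `1`. -/
def IsBinary (r : PositionalScoringRule) : Prop :=
  ∀ (m : ℕ) (j : Fin m), r.score m j = 0 ∨ r.score m j = 1

end PositionalScoringRule

/-- `k`-approval: the top `k` positions score `1`, the others `0`. -/
def kApproval (k : ℕ) : PositionalScoringRule where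
  score _ j := if (j : ℕ) < k then 1 else 0
  antitone m i j hij := by
    have h : (i : ℕ) ≤ j := hij
    dsimp only
    split_ifs <;> omega

/-- `k`-veto: the bottom `k` positions score `0`, the others `1`. -/
def kVeto (k : ℕ) : PositionalScoringRule where
  score m j := if (j : ℕ) + k < m then 1 else 0
  antitone m i j hij := by
    have h : (i : ℕ) ≤ j := hij
    dsimp only
    split_ifs <;> omega

/-! ### Encodings and polynomial time

Running times are those of Mathlib's multi-stack Turing machines, measured in the length of the
encoded input. Numbers of candidates, candidates and positions are written in unary. As an
instance lists its candidates, this changes the input length only polynomially; for score vectors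
it expresses that `score m j` is computed in time polynomial in `m`. Probabilities are rational
numbers whose numerators and denominators are written in binary. -/

/-- The input alphabet. -/
inductive InputSymbol : Type
  | bit (b : Bool)
  | endNumber
  | endVote
  | endProfile

/-- A natural number in unary, followed by an end marker. -/
def encodeUnary (n : ℕ) : List InputSymbol :=
  List.replicate n (InputSymbol.bit true) ++ [InputSymbol.endNumber]

/-- A natural number in binary, followed by an end marker. -/
def encodeBinary (n : ℕ) : List InputSymbol :=
  (Computability.encodeNat n).map InputSymbol.bit ++ [InputSymbol.endNumber]

/-- A ranking is written as the list of its candidates, from best to worst. -/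
def encodeRanking {m : ℕ} (v : Ranking m) : List InputSymbol :=
  (List.ofFn fun j : Fin m => encodeUnary (v j : ℕ)).flatten ++ [InputSymbol.endVote]

def encodeProfile {m : ℕ} (T : Profile m) : List InputSymbol :=
  T.flatMap encodeRanking ++ [InputSymbol.endProfile]

/-- A position `j` among `m` positions. -/
def encodePosition (x : (m : ℕ) × Fin m) : List InputSymbol :=
  encodeUnary x.1 ++ encodeUnary (x.2 : ℕ)

/-- The function `(m, j) ↦ score m j` is computable in time polynomial in `m`
(the value being written in binary). -/
def PositionalScoringRule.PolyTimeComputable (r : PositionalScoringRule) : Prop :=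
  Nonempty (Turing.TM2ComputableInPolyTime encodePosition Computability.encodeNat
    (fun x : (m : ℕ) × Fin m => r.score x.1 x.2))

/-- The decision problem `P`, on inputs `a` written as `enc a`, is decided by a Turing machine in
time polynomial in the length of `enc a`. -/
def PolyTimeDecidable {α Γ : Type} (enc : α → List Γ) (P : α → Prop) : Prop :=
  ∃ f : α → Bool, (∀ a, f a = true ↔ P a) ∧
    Nonempty (Turing.TM2ComputableInPolyTime enc Computability.encodeBool f)

/-! ### Control by adding an unlimited number of voters -/

/-- An instance of CCAUV: the candidates `Fin m`, the profile `M` of registered voters, the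
profile `Q` of unregistered voters, and the preferred candidate `c`. -/
structure CCAUVInstance where
  m : ℕ
  c : Fin m
  M : Profile m
  Q : Profile m

def CCAUVInstance.encode (I : CCAUVInstance) : List InputSymbol :=
  encodeUnary I.m ++ encodeUnary (I.c : ℕ) ++ encodeProfile I.M ++ encodeProfile I.Q

/-- The CCAUV question under the rule `r`: is there a sublist `Q'` of `Q` such that `c` is a
winner of the concatenation of `M` and `Q'`? -/
def CCAUV (r : PositionalScoringRule) (I : CCAUVInstance) : Prop :=
  ∃ Q' : Profile I.m, Q'.Sublist I.Q ∧ r.IsWinner (I.M ++ Q') I.c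

/-! ### The probability of winning -/

/-- A probabilistic voting profile with candidates `Fin m` and a distinguished candidate `c`:
every voter has a ranking and a rational probability in `[0, 1]` of participating. -/
structure WinInstance where
  m : ℕ
  c : Fin m
  voters : List (Ranking m × Set.Icc (0 : ℚ) 1)

namespace WinInstance

/-- The number of voters. -/
abbrev n (I : WinInstance) : ℕ := I.voters.length

/-- The probability that voter `i` participates. -/
def prob (I : WinInstance) (i : Fin I.n) : ℚ := ((I.voters.get i).2 : ℚ)

/-- The profile of the voters in `U`. -/
def subprofile (I : WinInstance) (U : Finset (Fin I.n)) : Profile I.m :=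
  ((List.finRange I.n).filter (· ∈ U)).map fun i => (I.voters.get i).1

/-- The probability that exactly the voters in `U` participate, the voters being independent. -/
def probSubset (I : WinInstance) (U : Finset (Fin I.n)) : ℚ :=
  (∏ i ∈ U, I.prob i) * ∏ i ∈ Uᶜ, (1 - I.prob i)

/-- The probability that `c` is a winner of the random profile of participating voters. -/
def winProb (r : PositionalScoringRule) (I : WinInstance) : ℚ :=
  ∑ U : Finset (Fin I.n) with r.IsWinner (I.subprofile U) I.c, I.probSubset U

def encodeVoter {m : ℕ} (v : Ranking m × Set.Icc (0 : ℚ) 1) : List InputSymbol :=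
  encodeRanking v.1 ++ encodeBinary (v.2 : ℚ).num.natAbs ++ encodeBinary (v.2 : ℚ).den

def encode (I : WinInstance) : List InputSymbol :=
  encodeUnary I.m ++ encodeUnary (I.c : ℕ) ++ I.voters.flatMap encodeVoter ++
    [InputSymbol.endProfile]

end WinInstance

open Turing

/-! ### Structured stack programs -/

/-! For a binary rule, a voter who gives `c` a point raises `c` by one and every rival by at most
one, so adding her never increases a rival's lead over `c`. A voter who gives `c` nothing can only
increase such leads. Hence it is optimal to add exactly the supporters of `c`, and comparing voter
by voter proves it: `IsBinary.totalScore_filter_le` and `IsBinary.exists_sublist_isWinner_iff`. For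
positive winning probability, voters of probability 1 act as registered, those of probability 0 as
absent and all others as unregistered. The same exchange argument gives `winProb_pos_iff_isWinner`.
Both questions thus reduce to evaluating a single election.

The rest is a proof that this evaluation is polynomial on a concrete multi-stack machine. Programs
are composed from structured pieces, and `Program.Runs` records the exact final stack contents
together with a step bound. It quantifies over all host machines containing the code, which makes it
compositional. The machine that computes the scores enters as a subroutine, simulated step for step
(`iterate_embedCfg`, `runs_call`), and is called once per position to tabulate a vector of bits.

Points are kept as a list of candidates in unary, one entry per point, so a candidate's score is her
multiplicity in the list. This list is never longer than the part of the input it comes from, so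
comparing all multiplicities with that of `c` takes polynomial time (`runs_decideWinner`).
`polyTimeDecidable_of_reader` assembles the machine. The two problems differ only in the program
that reads the voters. -/

instance : Fintype InputSymbol where
  elems := ⟨([.bit true, .bit false, .endNumber, .endVote, .endProfile] : List InputSymbol),
    by simp⟩
  complete x := by rcases x with (_ | _) | _ | _ | _ <;> simp

/-- `f` leads from configuration `a` to configuration `b` in at most `t` steps. -/
def ReachesIn {X : Type} (f : X → Option X) (a b : X) (t : ℕ) : Prop :=
  ∃ n ≤ t, (flip bind f)^[n] (some a) = some b

namespace ReachesIn

variable {X : Type} {f : X → Option X} {a b c : X} {t t' : ℕ}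

theorem trans (h : ReachesIn f a b t) (h' : ReachesIn f b c t') : ReachesIn f a c (t + t') := by
  obtain ⟨n, hn, h⟩ := h
  obtain ⟨n', hn', h'⟩ := h'
  exact ⟨n' + n, by omega, by rw [Function.iterate_add_apply, h, h']⟩

theorem single (h : f a = some b) : ReachesIn f a b 1 := ⟨1, le_rfl, h⟩

theorem mono (h : ReachesIn f a b t) (ht : t ≤ t') : ReachesIn f a b t' :=
  let ⟨n, hn, h⟩ := h
  ⟨n, hn.trans ht, h⟩

end ReachesIn

/-- The stacks of a program with user stacks `κ` and a subroutine machine `M`: the user stacks,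
one output stack, and the stacks of `M`. -/
abbrev StackIndex (κ : Type) (M : FinTM2) : Type := κ ⊕ (Unit ⊕ M.K)

@[reducible]
def StackAlphabet (κ : Type) (M : FinTM2) : StackIndex κ M → Type
  | .inl _ => InputSymbol
  | .inr (.inl _) => Bool
  | .inr (.inr k) => M.Γ k

/-- The control state: the state of the subroutine and a one-symbol buffer. -/
abbrev Control (M : FinTM2) : Type := M.σ × Option InputSymbol

/-- The contents of the user stacks. -/
abbrev Store (κ : Type) : Type := κ → List InputSymbol

abbrev ProgStmt (κ : Type) (M : FinTM2) (Λ : Type) : Type :=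
  TM2.Stmt (StackAlphabet κ M) Λ (Control M)

/-- A program is a finite piece of code with one entry, leaving through an exit label that is
supplied by the context. -/
structure Program (κ : Type) (M : FinTM2) where
  Label : Type
  fin : Fintype Label
  entry : Label
  code : {Λ : Type} → (Label → Λ) → Λ → Label → ProgStmt κ M Λ

section Stacks

variable {κ : Type} [DecidableEq κ] {M : FinTM2}

def allStacks (S : Store κ) (o : List Bool) (T : ∀ k, List (M.Γ k)) :
    ∀ k, List (StackAlphabet κ M k)
  | .inl k => S k
  | .inr (.inl _) => o
  | .inr (.inr k) => T k

def idle (M : FinTM2) : Control M := (M.initialState, none)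

/-- The invariant at the borders between pieces of code: output and subroutine stacks are empty and
the control is idle, so only the user store has to be tracked. -/
def progCfg (M : FinTM2) {Λ : Type} (l : Λ) (S : Store κ) :
    TM2.Cfg (StackAlphabet κ M) Λ (Control M) :=
  ⟨some l, idle M, allStacks S [] fun _ => []⟩

variable (S : Store κ) (o : List Bool) (T : ∀ k, List (M.Γ k))

omit [DecidableEq κ] in
@[simp] theorem allStacks_inl (k : κ) : allStacks S o T (.inl k) = S k := rfl

omit [DecidableEq κ] in
@[simp] theorem allStacks_out (u : Unit) : allStacks S o T (.inr (.inl u)) = o := rfl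

omit [DecidableEq κ] in
@[simp] theorem allStacks_inr (k : M.K) : allStacks S o T (.inr (.inr k)) = T k := rfl

@[simp] theorem update_allStacks_inl (k : κ) (x : List InputSymbol) :
    Function.update (allStacks S o T) (.inl k) x = allStacks (Function.update S k x) o T := by
  funext i
  rcases i with i | i | i
  · by_cases h : i = k
    · subst h; simp
    · simp [h]
  · simp
  · simp

@[simp] theorem update_allStacks_out (u : Unit) (x : List Bool) :
    Function.update (allStacks S o T) (.inr (.inl u)) x = allStacks S x T := by
  funext i
  rcases i with i | i | i
  · simp
  · simp
  · simp

@[simp] theorem update_allStacks_inr (k : M.K) (x : List (M.Γ k)) :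
    Function.update (allStacks S o T) (.inr (.inr k)) x =
      allStacks S o (Function.update T k x) := by
  funext i
  rcases i with i | i | i
  · simp
  · simp
  · by_cases h : i = k
    · subst h; simp
    · simp [h]

end Stacks

namespace Program

variable {κ : Type} [DecidableEq κ] {M : FinTM2}

/-- Started with user stacks `S`, the program reaches its exit with user stacks `S'` after at
most `t` steps. -/
def Runs (p : Program κ M) (S S' : Store κ) (t : ℕ) : Prop :=
  ∀ (Λ : Type) (m : Λ → ProgStmt κ M Λ) (emb : p.Label → Λ) (exit : Λ),
    (∀ l, m (emb l) = p.code emb exit l) →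
      ReachesIn (TM2.step m) (progCfg M (emb p.entry) S) (progCfg M exit S') t

theorem Runs.congr {p : Program κ M} {S S' S'' : Store κ} {t t' : ℕ} (h : p.Runs S S' t)
    (hS : S' = S'') (ht : t ≤ t') : p.Runs S S'' t' := by
  subst hS
  exact fun _ m emb exit hm => (h _ m emb exit hm).mono ht

def skip : Program κ M where
  Label := Unit
  fin := inferInstance
  entry := ()
  code _ exit _ := .goto fun _ => exit

def push (k : κ) (a : InputSymbol) : Program κ M where
  Label := Unit
  fin := inferInstance
  entry := ()
  code _ exit _ := .push (.inl k) (fun _ => a) (.goto fun _ => exit)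

def pop (k : κ) : Program κ M where
  Label := Unit
  fin := inferInstance
  entry := ()
  code _ exit _ := .pop (.inl k) (fun s _ => s) (.goto fun _ => exit)

/-- Move the top symbol of stack `a`, if there is one, to stack `b`. -/
def move (a b : κ) : Program κ M where
  Label := Unit
  fin := inferInstance
  entry := ()
  code _ exit _ := .pop (.inl a) (fun s x => (s.1, x)) (.branch (fun s => s.2.isSome)
    (.push (.inl b) (fun s => s.2.getD .endVote) (.load (fun s => (s.1, none))
      (.goto fun _ => exit))) (.goto fun _ => exit))

def seq (p q : Program κ M) : Program κ M where
  Label := p.Label ⊕ q.Label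
  fin := letI := p.fin; letI := q.fin; inferInstance
  entry := .inl p.entry
  code emb exit
    | .inl l => p.code (fun l => emb (.inl l)) (emb (.inr q.entry)) l
    | .inr l => q.code (fun l => emb (.inr l)) exit l

/-- Jump depending on the top symbol of a stack. -/
def test {Λ : Type} (k : κ) (P : Option InputSymbol → Bool) (l l' : Λ) : ProgStmt κ M Λ :=
  .peek (.inl k) (fun s x => (s.1, x)) (.branch (fun s => P s.2)
    (.load (fun s => (s.1, none)) (.goto fun _ => l))
    (.load (fun s => (s.1, none)) (.goto fun _ => l')))

def ifTop (k : κ) (P : Option InputSymbol → Bool) (p q : Program κ M) : Program κ M where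
  Label := Option (p.Label ⊕ q.Label)
  fin := letI := p.fin; letI := q.fin; inferInstance
  entry := none
  code emb exit
    | none => test k P (emb (some (.inl p.entry))) (emb (some (.inr q.entry)))
    | some (.inl l) => p.code (fun l => emb (some (.inl l))) exit l
    | some (.inr l) => q.code (fun l => emb (some (.inr l))) exit l

def whileTop (k : κ) (P : Option InputSymbol → Bool) (p : Program κ M) : Program κ M where
  Label := Option p.Label
  fin := letI := p.fin; inferInstance
  entry := none
  code emb exit
    | none => test k P (emb (some p.entry)) exit
    | some l => p.code (fun l => emb (some l)) (emb none) l

/-- A machine step executes a whole statement up to its next jump, so a labelled block costs one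
step whatever its length. -/
theorem reachesIn_of_code {Λ : Type} {m : Λ → ProgStmt κ M Λ} {l : Λ} {q : ProgStmt κ M Λ}
    (hm : m l = q) {v : Control M} {T : ∀ k, List (StackAlphabet κ M k)}
    {c : TM2.Cfg (StackAlphabet κ M) Λ (Control M)} (h : TM2.stepAux q v T = c) :
    ReachesIn (TM2.step m) ⟨some l, v, T⟩ c 1 :=
  ReachesIn.single (by rw [TM2.step, hm, h])

theorem runs_skip (S : Store κ) : (skip : Program κ M).Runs S S 1 :=
  fun _ m emb exit hm => reachesIn_of_code (hm ()) (by simp [progCfg, skip])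

theorem runs_push (k : κ) (a : InputSymbol) (S : Store κ) :
    (push k a : Program κ M).Runs S (Function.update S k (a :: S k)) 1 :=
  fun _ m emb exit hm => reachesIn_of_code (hm ()) (by simp [progCfg, push])

theorem runs_pop (k : κ) (S : Store κ) :
    (pop k : Program κ M).Runs S (Function.update S k (S k).tail) 1 :=
  fun _ m emb exit hm => reachesIn_of_code (hm ()) (by simp [progCfg, pop])

theorem runs_move {a b : κ} (hab : a ≠ b) {S : Store κ} {x : InputSymbol}
    {w : List InputSymbol} (h : S a = x :: w) :
    (move a b : Program κ M).Runs S (Function.update (Function.update S a w) b (x :: S b)) 1 :=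
  fun _ m emb exit hm => reachesIn_of_code (hm ()) (by simp [progCfg, move, h, idle, hab.symm])

theorem Runs.seq {p q : Program κ M} {S S' S'' : Store κ} {t t' : ℕ} (h : p.Runs S S' t)
    (h' : q.Runs S' S'' t') : (p.seq q).Runs S S'' (t + t') :=
  fun _ m emb exit hm =>
    (h _ m (fun l => emb (.inl l)) (emb (.inr q.entry)) fun l => hm (.inl l)).trans
      (h' _ m (fun l => emb (.inr l)) exit fun l => hm (.inr l))

theorem step_test {Λ : Type} {m : Λ → ProgStmt κ M Λ} {k : κ} {P : Option InputSymbol → Bool}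
    {l l₁ l₂ : Λ} (hm : m l = test k P l₁ l₂) (S : Store κ) :
    TM2.step m (progCfg M l S) = some (progCfg M (if P (S k).head? then l₁ else l₂) S) := by
  simp only [progCfg, TM2.step, hm, test, TM2.stepAux, allStacks_inl]
  cases P (S k).head? <;> simp [idle]

theorem runs_ifTop_true {k : κ} {P : Option InputSymbol → Bool} {p q : Program κ M}
    {S S' : Store κ} {t : ℕ} (hP : P (S k).head? = true) (h : p.Runs S S' t) :
    (ifTop k P p q).Runs S S' (1 + t) := fun _ m emb exit hm => by
  refine (ReachesIn.single ?_).trans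
    (h _ m (fun l => emb (some (.inl l))) exit fun l => hm (some (.inl l)))
  exact (step_test (hm none) S).trans (by rw [hP]; rfl)

theorem runs_ifTop_false {k : κ} {P : Option InputSymbol → Bool} {p q : Program κ M}
    {S S' : Store κ} {t : ℕ} (hP : P (S k).head? = false) (h : q.Runs S S' t) :
    (ifTop k P p q).Runs S S' (1 + t) := fun _ m emb exit hm => by
  refine (ReachesIn.single ?_).trans
    (h _ m (fun l => emb (some (.inr l))) exit fun l => hm (some (.inr l)))
  exact (step_test (hm none) S).trans (by rw [hP]; rfl)

theorem runs_whileTop_false {k : κ} {P : Option InputSymbol → Bool} {p : Program κ M}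
    {S : Store κ} (hP : P (S k).head? = false) : (whileTop k P p).Runs S S 1 :=
  fun _ m emb exit hm => ReachesIn.single ((step_test (hm none) S).trans (by rw [hP]; rfl))

theorem runs_whileTop_true {k : κ} {P : Option InputSymbol → Bool} {p : Program κ M}
    {S S' S'' : Store κ} {t t' : ℕ} (hP : P (S k).head? = true) (h : p.Runs S S' t)
    (h' : (whileTop k P p).Runs S' S'' t') : (whileTop k P p).Runs S S'' (1 + t + t') :=
  fun _ m emb exit hm => by
    refine ((ReachesIn.single ?_).trans
      (h _ m (fun l => emb (some l)) (emb none) fun l => hm (some l))).trans (h' _ m emb exit hm)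
    exact (step_test (hm none) S).trans (by rw [hP]; rfl)

/-! #### Calling the subroutine -/

/-- The code of the subroutine, with halting replaced by a jump to `done`. -/
def embedStmt {Λ : Type} (run : M.Λ → Λ) (done : Λ) :
    TM2.Stmt M.Γ M.Λ M.σ → ProgStmt κ M Λ
  | .push k f q => .push (.inr (.inr k)) (fun s => f s.1) (embedStmt run done q)
  | .peek k f q => .peek (.inr (.inr k)) (fun s x => (f s.1 x, s.2)) (embedStmt run done q)
  | .pop k f q => .pop (.inr (.inr k)) (fun s x => (f s.1 x, s.2)) (embedStmt run done q)
  | .load f q => .load (fun s => (f s.1, s.2)) (embedStmt run done q)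
  | .branch f q q' => .branch (fun s => f s.1) (embedStmt run done q) (embedStmt run done q')
  | .goto f => .goto fun s => run (f s.1)
  | .halt => .goto fun _ => done

def embedCfg {Λ : Type} (run : M.Λ → Λ) (done : Λ) (S : Store κ)
    (c : TM2.Cfg M.Γ M.Λ M.σ) : TM2.Cfg (StackAlphabet κ M) Λ (Control M) :=
  ⟨some (c.l.elim done run), (c.var, none), allStacks S [] c.stk⟩

/-- Embedded code touches only the subroutine's own stacks and the first component of the control,
so the simulation is in lockstep and leaves the user store alone. -/
theorem stepAux_embedStmt {Λ : Type} (run : M.Λ → Λ) (done : Λ) (S : Store κ)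
    (q : TM2.Stmt M.Γ M.Λ M.σ) (v : M.σ) (T : ∀ k, List (M.Γ k)) :
    TM2.stepAux (embedStmt run done q) (v, none) (allStacks S [] T) =
      embedCfg run done S (TM2.stepAux q v T) := by
  induction q generalizing v T with
  | push k f q ih => simp [embedStmt, ih]
  | peek k f q ih => simp [embedStmt, ih]
  | pop k f q ih => simp [embedStmt, ih]
  | load f q ih => simp [embedStmt, ih]
  | branch f q q' ih ih' => cases h : f v <;> simp [embedStmt, ih, ih', h]
  | goto f => rfl
  | halt => rfl

theorem iterate_embedCfg {Λ : Type} {m : Λ → ProgStmt κ M Λ} {run : M.Λ → Λ} {done : Λ}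
    (hm : ∀ l, m (run l) = embedStmt run done (M.m l)) (S : Store κ) (n : ℕ)
    (a b : TM2.Cfg M.Γ M.Λ M.σ)
    (h : (flip bind (TM2.step M.m))^[n] (some a) = some b) :
    (flip bind (TM2.step m))^[n] (some (embedCfg run done S a)) =
      some (embedCfg run done S b) := by
  induction n generalizing b with
  | zero =>
    obtain rfl : a = b := by simpa using h
    rfl
  | succ n ih =>
    rw [Function.iterate_succ_apply'] at h ⊢
    -- A halted configuration has no successor, so before the last step the subroutine is still at a
    -- label and the jump to `done` has not yet been taken.
    rcases hc : (flip bind (TM2.step M.m))^[n] (some a) with _ | ⟨_ | l, v, T⟩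
    · rw [hc] at h
      cases h
    · rw [hc] at h
      cases h
    · rw [hc] at h
      rw [ih _ hc]
      have h' : TM2.stepAux (M.m l) v T = b := Option.some.inj h
      refine congrArg some ?_
      change TM2.stepAux (m (run l)) (v, none) (allStacks S [] T) = _
      rw [hm, stepAux_embedStmt, h']

/-- Empty stack `a` into the input stack of the subroutine, run the subroutine, and push on
stack `b` the information whether its output is nonempty. -/
def call (e : M.Γ M.k₀ ≃ InputSymbol) (a b : κ) : Program κ M where
  Label := Option (Option M.Λ)
  fin := letI := M.ΛFin; inferInstance
  entry := none
  code emb exit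
    | none => .pop (.inl a) (fun s x => (s.1, x)) (.branch (fun s => s.2.isSome)
        (.push (.inr (.inr M.k₀)) (fun s => e.symm (s.2.getD .endVote))
          (.load (fun s => (s.1, none)) (.goto fun _ => emb none)))
        (.goto fun _ => emb (some (some M.main))))
    | some none => .pop (.inr (.inr M.k₁)) (fun s x => (s.1, x.map fun _ => .endVote))
        (.push (.inl b) (fun s => .bit s.2.isSome) (.load (fun s => (s.1, none))
          (.goto fun _ => exit)))
    | some (some l) => embedStmt (fun l => emb (some (some l))) (emb (some none)) (M.m l)

theorem initList_eq (w : List (M.Γ M.k₀)) :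
    initList M w = ⟨some M.main, M.initialState, Function.update (fun _ => []) M.k₀ w⟩ := by
  unfold initList
  congr 1
  funext k
  by_cases h : k = M.k₀
  · subst h; simp
  · simp [h]

theorem haltList_eq (w : List (M.Γ M.k₁)) :
    haltList M w = ⟨none, M.initialState, Function.update (fun _ => []) M.k₁ w⟩ := by
  unfold haltList
  congr 1
  funext k
  by_cases h : k = M.k₁
  · subst h; simp
  · simp [h]

/-- Popping the argument into the input stack reverses it, hence `w.reverse`. The subroutine halts
with all stacks but its output empty; as the output has at most one symbol, a single pop restores
the invariant for the next call. -/
theorem runs_call {e : M.Γ M.k₀ ≃ InputSymbol} {a b : κ} {S : Store κ} {w : List InputSymbol}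
    {u : List (M.Γ M.k₁)} {t : ℕ} (hS : S a = w.reverse) (hu : u.length ≤ 1)
    (h : TM2OutputsInTime M (w.map e.symm) (some u) t) :
    (call e a b).Runs S (Function.update (Function.update S a []) b
      (.bit (!u.isEmpty) :: Function.update S a [] b)) (w.length + t + 2) := by
  intro Λ m emb exit hm
  -- Here `z` is the part of the argument already transferred, generalized for the induction.
  have load : ∀ (v : List InputSymbol) (S : Store κ) (z : List (M.Γ M.k₀)), S a = v →
      ReachesIn (TM2.step m)
        ⟨some (emb none), idle M, allStacks S [] (Function.update (fun _ => []) M.k₀ z)⟩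
        ⟨some (emb (some (some M.main))), idle M, allStacks (Function.update S a []) []
          (Function.update (fun _ => []) M.k₀ (v.reverse.map e.symm ++ z))⟩ (v.length + 1) := by
    intro v
    induction v with
    | nil =>
      intro S z h
      exact reachesIn_of_code (hm none) (by simp [call, h, idle])
    | cons x v ih =>
      intro S z h
      have := ih (Function.update S a v) (e.symm x :: z) (by simp)
      rw [Function.update_idem] at this
      rw [List.reverse_cons, List.map_append, List.append_assoc]
      refine ((reachesIn_of_code (hm none) ?_).trans this).mono (add_comm _ _).le
      simp [call, h, idle]
  have run := iterate_embedCfg (m := m) (run := fun l => emb (some (some l)))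
    (done := emb (some none)) (fun l => hm (some (some l))) (Function.update S a []) h.steps _ _
    h.evals_in_steps
  simp only [initList_eq, haltList_eq] at run
  have hload := load _ S [] hS
  rw [List.reverse_reverse, List.append_nil, List.length_reverse] at hload
  have nil : Function.update (fun _ => [] : ∀ k, List (M.Γ k)) M.k₀ [] = fun _ => [] :=
    Function.update_eq_self M.k₀ _
  rw [nil] at hload
  refine ((hload.trans ⟨_, h.steps_le_m, run⟩).trans
    (reachesIn_of_code (hm (some none)) ?_)).mono (by omega)
  rcases u with _ | ⟨x, _ | _⟩
  · simp [call, progCfg, idle]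
  · simp [call, progCfg, idle]
  · simp at hu

/-! #### Complete machines -/

/-- The machine that runs `p` on the input stack `i` and then outputs `true` or `default`
depending on whether the stack `o` is nonempty. -/
def toMachine [Fintype κ] (p : Program κ M) (i o : κ) (default : Option Bool) : FinTM2 where
  K := StackIndex κ M
  kFin := letI := M.kFin; inferInstance
  k₀ := .inl i
  k₁ := .inr (.inl ())
  Γ := StackAlphabet κ M
  Λ := Option p.Label
  main := some p.entry
  ΛFin := letI := p.fin; inferInstance
  σ := Control M
  initialState := idle M
  σFin := letI := M.σFin; inferInstance
  Γk₀Fin := inferInstanceAs (Fintype InputSymbol)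
  m
    | some l => p.code some none l
    | none => .pop (.inl o) (fun s x => (s.1, x)) (.branch (fun s => s.2.isSome)
        (.push (.inr (.inl ())) (fun _ => true) (.load (fun _ => idle M) .halt))
        (.load (fun _ => idle M) (match default with
          | none => .halt
          | some b => .push (.inr (.inl ())) (fun _ => b) .halt)))

/-- The machine model requires all stacks other than the output to be empty at halting and the state
to be the initial one, so a program must clean up everything except its one-symbol result. The extra
step is the block that writes the answer. -/
theorem outputs_toMachine [Fintype κ] {p : Program κ M} {i o : κ} {default : Option Bool}
    {w : List InputSymbol} {b : Bool} {t : ℕ}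
    (h : p.Runs (Function.update (fun _ => []) i w)
      (Function.update (fun _ => []) o (if b then [.endVote] else [])) t) :
    Nonempty (TM2OutputsInTime (p.toMachine i o default) w
      (some (if b then [true] else default.toList)) (t + 1)) := by
  have := (h _ (p.toMachine i o default).m some none fun _ => rfl).trans
    (reachesIn_of_code (m := (p.toMachine i o default).m) (l := none) rfl rfl)
  obtain ⟨n, hn, h⟩ := this
  refine ⟨⟨⟨n, ?_⟩, hn⟩⟩
  have nil : (fun _ => [] : ∀ k, List (StackAlphabet κ M k)) =
      allStacks (fun _ => []) [] fun _ => [] := by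
    funext k
    rcases k with _ | _ | _ <;> rfl
  have hi : initList (p.toMachine i o default) w =
      progCfg M (some p.entry) (Function.update (fun _ => []) i w) := by
    refine (initList_eq (M := p.toMachine i o default) w).trans ?_
    refine congrArg (TM2.Cfg.mk (some (some p.entry)) (idle M)) ?_
    change Function.update (fun _ => [] : ∀ k, List (StackAlphabet κ M k)) (.inl i) w = _
    rw [nil, update_allStacks_inl]
  have ho (u : List Bool) : haltList (p.toMachine i o default) u =
      ⟨none, idle M, allStacks (fun _ => []) u fun _ => []⟩ := by
    refine (haltList_eq (M := p.toMachine i o default) u).trans ?_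
    refine congrArg (TM2.Cfg.mk none (idle M)) ?_
    change Function.update (fun _ => [] : ∀ k, List (StackAlphabet κ M k)) (.inr (.inl ())) u = _
    rw [nil, update_allStacks_out]
  refine Eq.trans (congrArg _ (congrArg some hi)) (h.trans (congrArg some ?_))
  refine Eq.trans ?_ (ho _).symm
  cases b <;> rcases default with _ | d <;> simp [toMachine, idle]

end Program

/-! ### Elementary subroutines -/

/-- The unary counter with value `n`. -/
def ones (n : ℕ) : List InputSymbol := List.replicate n (.bit true)

@[simp] theorem ones_zero : ones 0 = [] := rfl

theorem ones_succ (n : ℕ) : ones (n + 1) = .bit true :: ones n := rfl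

@[simp] theorem ones_append (m n : ℕ) : ones m ++ ones n = ones (m + n) :=
  List.replicate_append_replicate

@[simp] theorem ones_append_append (m n : ℕ) (w : List InputSymbol) :
    ones m ++ (ones n ++ w) = ones (m + n) ++ w := by
  rw [← List.append_assoc, ones_append]

@[simp] theorem length_ones (n : ℕ) : (ones n).length = n := List.length_replicate

@[simp] theorem reverse_ones (n : ℕ) : (ones n).reverse = ones n := List.reverse_replicate

theorem ones_append_cons (n : ℕ) (w : List InputSymbol) :
    ones n ++ .bit true :: w = .bit true :: (ones n ++ w) := by
  induction n with
  | zero => rfl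
  | succ n ih => rw [ones_succ, List.cons_append, ih, List.cons_append]

@[simp] theorem isSome_head_ones (n : ℕ) : (ones n).head?.isSome = decide (n ≠ 0) := by
  cases n <;> simp [ones_succ]

@[simp] theorem tail_ones (n : ℕ) : (ones n).tail = ones (n - 1) := by
  cases n <;> simp [ones_succ]

theorem encodeUnary_eq (n : ℕ) : encodeUnary n = ones n ++ [.endNumber] := rfl

def isBit : Option InputSymbol → Bool
  | some (.bit _) => true
  | _ => false

namespace Program

variable {κ : Type} [DecidableEq κ] {M : FinTM2}

open Function (update)

theorem runs_moveWhile {a b : κ} (hab : a ≠ b) {P : Option InputSymbol → Bool}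
    {w rest : List InputSymbol} {S : Store κ} (h : S a = w ++ rest)
    (hw : ∀ x ∈ w, P (some x) = true) (hr : P rest.head? = false) :
    (whileTop a P (move a b) : Program κ M).Runs S
      (update (update S a rest) b (w.reverse ++ S b)) (2 * w.length + 1) := by
  induction w generalizing S with
  | nil =>
    refine (runs_whileTop_false (by simpa [h] using hr)).congr ?_ le_rfl
    rw [List.nil_append] at h
    rw [← h]
    simp
  | cons x w ih =>
    refine (runs_whileTop_true (by simp [h, hw]) (runs_move hab (w := w ++ rest) h)
      (ih (by simp [hab]) fun y hy => hw y (List.mem_cons_of_mem _ hy))).congr ?_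
      (by simp; omega)
    funext i
    simp only [Function.update_apply]
    split_ifs <;> simp_all

theorem runs_popWhile {a : κ} {P : Option InputSymbol → Bool} {w rest : List InputSymbol}
    {S : Store κ} (h : S a = w ++ rest) (hw : ∀ x ∈ w, P (some x) = true)
    (hr : P rest.head? = false) :
    (whileTop a P (pop a) : Program κ M).Runs S (update S a rest) (2 * w.length + 1) := by
  induction w generalizing S with
  | nil =>
    refine (runs_whileTop_false (by simpa [h] using hr)).congr ?_ le_rfl
    rw [List.nil_append] at h
    rw [← h]
    simp
  | cons x w ih =>
    exact (runs_whileTop_true (by simp [h, hw]) (runs_pop a S)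
      (ih (by simp [h]) fun y hy => hw y (List.mem_cons_of_mem _ hy))).congr (by simp)
      (by simp; omega)

def clear (a : κ) : Program κ M := whileTop a Option.isSome (pop a)

theorem runs_clear (a : κ) (S : Store κ) :
    (clear a : Program κ M).Runs S (update S a []) (2 * (S a).length + 1) :=
  runs_popWhile (List.append_nil _).symm (by simp) rfl

def moveAll (a b : κ) : Program κ M := whileTop a Option.isSome (move a b)

theorem runs_moveAll {a b : κ} (hab : a ≠ b) (S : Store κ) :
    (moveAll a b : Program κ M).Runs S (update (update S a []) b ((S a).reverse ++ S b))
      (2 * (S a).length + 1) :=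
  runs_moveWhile hab (List.append_nil _).symm (by simp) rfl

/-- Read a unary number from stack `a` into the counter `b`. -/
def readNumber (a b : κ) : Program κ M := (whileTop a isBit (move a b)).seq (pop a)

theorem runs_readNumber {a b : κ} (hab : a ≠ b) {S : Store κ} {n : ℕ} {rest : List InputSymbol}
    (h : S a = encodeUnary n ++ rest) :
    (readNumber a b : Program κ M).Runs S (update (update S a rest) b (ones n ++ S b))
      (2 * n + 2) := by
  rw [encodeUnary_eq, List.append_assoc] at h
  refine ((runs_moveWhile hab h (by simp [ones, isBit]) rfl).seq (runs_pop a _)).congr ?_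
    (by simp)
  funext i
  simp only [Function.update_apply]
  split_ifs <;> simp_all

/-- Remove a number from stack `a`. -/
def skipNumber (a : κ) : Program κ M := (whileTop a isBit (pop a)).seq (pop a)

theorem runs_skipNumber {a : κ} {S : Store κ} {w rest : List InputSymbol}
    (hw : ∀ x ∈ w, isBit (some x) = true) (h : S a = w ++ .endNumber :: rest) :
    (skipNumber a : Program κ M).Runs S (update S a rest) (2 * w.length + 2) :=
  ((runs_popWhile h hw rfl).seq (runs_pop a _)).congr (by simp) le_rfl

/-- Add the counter `a` to the counter `b`, using the scratch stack `x`. -/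
def copy (a b x : κ) : Program κ M :=
  (moveAll a x).seq (whileTop x Option.isSome ((move x a).seq (push b (.bit true))))

theorem runs_copy {a b x : κ} (hab : a ≠ b) (hax : a ≠ x) (hbx : b ≠ x) {S : Store κ} {n : ℕ}
    (ha : S a = ones n) (hx : S x = []) :
    (copy a b x : Program κ M).Runs S (update S b (ones n ++ S b)) (5 * n + 2) := by
  have loop : ∀ (n : ℕ) (S : Store κ), S x = ones n →
      (whileTop x Option.isSome ((move x a).seq (push b (.bit true))) : Program κ M).Runs S
        (update (update (update S x []) a (ones n ++ S a)) b (ones n ++ S b)) (3 * n + 1) := by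
    intro n
    induction n with
    | zero =>
      intro S h
      refine (runs_whileTop_false (by simp [h])).congr ?_ le_rfl
      funext i
      simp only [Function.update_apply]
      split_ifs <;> simp_all
    | succ n ih =>
      intro S h
      refine (runs_whileTop_true (by simp [h]) ((runs_move hax.symm (w := ones n) h).seq
        (runs_push b _ _))
        (ih _ (by simp [hax.symm, hbx.symm]))).congr ?_ (by omega)
      funext i
      simp only [Function.update_apply]
      split_ifs <;> simp_all [ones_append_cons, ones_succ]
  refine ((runs_moveAll hax S).seq (loop n _ (by simp [ha, hx]))).congr ?_ (by simp [ha]; omega)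
  funext i
  simp only [Function.update_apply]
  split_ifs <;> simp_all

/-- Remove as many symbols from `b` as there are on `a`, emptying `a`. -/
def cancel (a b : κ) : Program κ M := whileTop a Option.isSome ((pop a).seq (pop b))

/-- Popping an empty stack has no effect, which is exactly truncated subtraction. -/
theorem runs_cancel {a b : κ} (hab : a ≠ b) {S : Store κ} {m n : ℕ} (ha : S a = ones m)
    (hb : S b = ones n) :
    (cancel a b : Program κ M).Runs S (update (update S a []) b (ones (n - m))) (3 * m + 1) := by
  induction m generalizing n S with
  | zero =>
    refine (runs_whileTop_false (by simp [ha])).congr ?_ le_rfl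
    funext i
    simp only [Function.update_apply]
    split_ifs <;> simp_all
  | succ m ih =>
    refine (runs_whileTop_true (by simp [ha]) ((runs_pop a _).seq (runs_pop b _))
      (ih (n := n - 1) (by simp [ha, hab]) (by simp [hb, hab.symm]))).congr ?_ (by omega)
    funext i
    simp only [Function.update_apply]
    split_ifs <;> simp_all
    congr 1
    omega

/-- Move a unary number from stack `a` to stack `b`, and push a symbol on the counter `out` if its
value is that of the counter `r`. -/
def compare (a b r x y out : κ) : Program κ M :=
  (whileTop a isBit ((move a b).seq (ifTop r Option.isSome (move r x) (push y (.bit true))))).seq <|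
  (move a b).seq <|
  (ifTop r Option.isSome skip (ifTop y Option.isSome skip (push out (.bit true)))).seq <|
  (clear y).seq (moveAll x r)

/-- While the number is read, `x` collects the matched part `min n k`, `y` the surplus `n - k`, and
`r` retains `k - n`. The values agree iff `r` and `y` both end up empty, and moving `x` back
restores `r`. -/
theorem runs_compare {a b r x y out : κ} (hd : [a, b, r, x, y, out].Nodup) {S : Store κ}
    {n k : ℕ} {rest : List InputSymbol} (ha : S a = encodeUnary n ++ rest) (hr : S r = ones k)
    (hx : S x = []) (hy : S y = []) :
    (compare a b r x y out : Program κ M).Runs S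
      (update (update (update S a rest) b ((encodeUnary n).reverse ++ S b)) out
        (ones (if n = k then 1 else 0) ++ S out)) (8 * (n + 1)) := by
  simp only [List.nodup_cons, List.mem_cons, List.not_mem_nil, or_false, not_or, ← ne_eq,
    not_false_eq_true, List.nodup_nil, and_true] at hd
  obtain ⟨⟨hab, har, hax, hay, hao⟩, ⟨hbr, hbx, hby, hbo⟩, ⟨hrx, hry, hro⟩, ⟨hxy, hxo⟩, hyo⟩ := hd
  have loop : ∀ (n k : ℕ) (S : Store κ), S a = ones n ++ .endNumber :: rest → S r = ones k →
      (whileTop a isBit ((move a b).seq (ifTop r Option.isSome (move r x) (push y (.bit true)))) :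
        Program κ M).Runs S
        (update (update (update (update (update S a (.endNumber :: rest)) b (ones n ++ S b))
          r (ones (k - n))) x (ones (min n k) ++ S x)) y (ones (n - k) ++ S y)) (4 * n + 1) := by
    intro n
    induction n with
    | zero =>
      intro k S h hk
      refine (runs_whileTop_false (by simp [h, isBit])).congr ?_ le_rfl
      funext i
      simp only [Function.update_apply]
      split_ifs <;> simp_all
    | succ n ih =>
      intro k S h hk
      cases k with
      | zero =>
        refine (runs_whileTop_true (by simp [h, isBit, ones_succ])
          ((runs_move hab (w := ones n ++ .endNumber :: rest) h).seq
          (runs_ifTop_false (by simp [hk, har.symm, hbr.symm]) (runs_push y _ _)))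
          (ih 0 _ (by simp [hab, hay]) (by simp [hk, har.symm, hbr.symm, hry]))).congr ?_ (by omega)
        funext i
        simp only [Function.update_apply]
        split_ifs <;> simp_all [ones_append_cons, ones_succ]
      | succ k =>
        refine (runs_whileTop_true (by simp [h, isBit, ones_succ])
          ((runs_move hab (w := ones n ++ .endNumber :: rest) h).seq
          (runs_ifTop_true (by simp [hk, har.symm, hbr.symm]) (runs_move hrx
            (x := .bit true) (w := ones k) (by simp [hk, har.symm, hbr.symm, ones_succ]))))
          (ih k _ (by simp [hab, har, hax]) (by simp [hrx]))).congr ?_ (by omega)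
        funext i
        simp only [Function.update_apply]
        split_ifs <;> simp_all [ones_append_cons, ones_succ, Nat.add_min_add_right]
  rw [encodeUnary_eq, List.append_assoc] at ha
  have check : ∀ S' : Store κ, S' r = ones (k - n) → S' y = ones (n - k) →
      (ifTop r Option.isSome skip (ifTop y Option.isSome skip (push out (.bit true))) :
        Program κ M).Runs S' (update S' out (ones (if n = k then 1 else 0) ++ S' out)) 3 := by
    intro S' hr' hy'
    rcases lt_trichotomy n k with h | rfl | h
    · refine (runs_ifTop_true ?_ (runs_skip S')).congr ?_ (by omega)
      · simp [hr']; omega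
      · simp [h.ne]
    · exact (runs_ifTop_false (by simp [hr']) (runs_ifTop_false (by simp [hy'])
        (runs_push _ _ S'))).congr (by simp [ones_succ]) (by omega)
    · refine (runs_ifTop_false ?_ (runs_ifTop_true ?_ (runs_skip S'))).congr ?_ (by omega)
      · simp [hr']; omega
      · simp [hy']; omega
      · simp [h.ne']
  refine ((loop n k S ha hr).seq <| (runs_move hab (x := .endNumber) (w := rest)
    (by simp [hab, har, hax, hay])).seq <| (check _ ?_ ?_).seq <|
      (runs_clear y _).seq (runs_moveAll hrx.symm _)).congr ?_ ?_
  · simp [hbr.symm, har.symm, hrx, hry]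
  · simp [hby.symm, hay.symm, hy]
  · have : min n k + (k - n) = k := by omega
    clear loop check
    funext i
    rcases eq_or_ne i out with rfl | ho
    · simp [*, hao.symm, hbo.symm, hro.symm, hyo.symm, hxo.symm]
    rcases eq_or_ne i r with rfl | hir
    · simp [*, har.symm, hbr.symm, hax.symm, hbx.symm]
    rcases eq_or_ne i b with rfl | hib
    · simp [*, encodeUnary_eq]
    rcases eq_or_ne i a with rfl | hia
    · simp [*]
    rcases eq_or_ne i y with rfl | hiy
    · simp [*, hxy.symm]
    rcases eq_or_ne i x with rfl | hix
    · simp [*]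
    simp [*]
  · simp [hyo, hxo, hby.symm, hay.symm, hxy, hbx.symm, hax.symm, hx, hy]
    omega

/-- Count the numbers on stack `a` that are equal to the counter `r`, using the counter `out`. -/
def countEqual (a b r x y out : κ) : Program κ M :=
  (whileTop a Option.isSome (compare a b r x y out)).seq (moveAll b a)

/-- The list passes to `b` in reverse and is moved back at the end, so it survives for the next
count. -/
theorem runs_countEqual {a b r x y out : κ} (hd : [a, b, r, x, y, out].Nodup) {S : Store κ}
    {ns : List ℕ} {k : ℕ} (ha : S a = ns.flatMap encodeUnary) (hb : S b = []) (hr : S r = ones k)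
    (hx : S x = []) (hy : S y = []) :
    (countEqual a b r x y out : Program κ M).Runs S (update S out (ones (ns.count k) ++ S out))
      (11 * (ns.flatMap encodeUnary).length + 2) := by
  have hd' := hd
  simp only [List.nodup_cons, List.mem_cons, List.not_mem_nil, or_false, not_or, ← ne_eq,
    not_false_eq_true, List.nodup_nil, and_true] at hd'
  obtain ⟨⟨hab, har, hax, hay, hao⟩, ⟨hbr, hbx, hby, hbo⟩, ⟨hrx, hry, hro⟩, ⟨hxy, hxo⟩, hyo⟩ := hd'
  have loop : ∀ (ns : List ℕ) (S : Store κ), S a = ns.flatMap encodeUnary → S r = ones k →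
      S x = [] → S y = [] →
      (whileTop a Option.isSome (compare a b r x y out) : Program κ M).Runs S
        (update (update (update S a []) b ((ns.flatMap encodeUnary).reverse ++ S b)) out
          (ones (ns.count k) ++ S out)) (9 * (ns.flatMap encodeUnary).length + 1) := by
    intro ns
    induction ns with
    | nil =>
      intro S ha hr hx hy
      refine (runs_whileTop_false (by simp [ha])).congr ?_ (by simp)
      have : update S a [] = S := by
        conv_rhs => rw [← Function.update_eq_self a S, ha, List.flatMap_nil]
      simp [this]
    | cons n ns ih =>
      intro S ha hr hx hy
      refine (runs_whileTop_true (by simp [ha, encodeUnary]) (runs_compare hd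
        (rest := ns.flatMap encodeUnary) ha hr hx hy)
        (ih _ ?_ ?_ ?_ ?_)).congr ?_ ?_
      · simp [hab, hao]
      · simp [hr, har.symm, hbr.symm, hro]
      · simp [hx, hax.symm, hbx.symm, hxo]
      · simp [hy, hay.symm, hby.symm, hyo]
      · funext i
        rcases eq_or_ne i out with rfl | ho
        · simp [List.count_cons]
        rcases eq_or_ne i b with rfl | hib
        · simp [ho]
        rcases eq_or_ne i a with rfl | hia
        · simp [*]
        simp [*]
      · simp [encodeUnary]
        omega
  refine ((loop ns S ha hr hx hy).seq (runs_moveAll hab.symm _)).congr ?_ ?_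
  · clear loop
    funext i
    rcases eq_or_ne i out with rfl | ho
    · simp [*, hao.symm, hbo.symm]
    rcases eq_or_ne i b with rfl | hib
    · simp [*, hab.symm]
    rcases eq_or_ne i a with rfl | hia
    · simp [*]
    simp [*]
  · simp [hbo, hb]
    omega

end Program

/-! ### The decision procedure -/

/-- The stacks of the decision procedure. -/
inductive Reg : Type
  | inp | cands | pref | idx | vec | vec' | tmp | flag | aux | exc | arg | pts | pts'
  | sum | sum' | fail | res
  deriving DecidableEq

instance : Fintype Reg where
  elems := ⟨([.inp, .cands, .pref, .idx, .vec, .vec', .tmp, .flag, .aux, .exc, .arg, .pts, .pts',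
    .sum, .sum', .fail, .res] : List Reg), by simp⟩
  complete x := by cases x <;> simp

/-- Numbers in unary, one after the other. -/
def encodeNumbers (ns : List ℕ) : List InputSymbol := ns.flatMap encodeUnary

@[simp] theorem encodeNumbers_nil : encodeNumbers [] = [] := rfl

@[simp] theorem encodeNumbers_cons (n : ℕ) (ns : List ℕ) :
    encodeNumbers (n :: ns) = encodeUnary n ++ encodeNumbers ns := rfl

@[simp] theorem encodeNumbers_append (ns ns' : List ℕ) :
    encodeNumbers (ns ++ ns') = encodeNumbers ns ++ encodeNumbers ns' := List.flatMap_append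

theorem length_encodeUnary (n : ℕ) : (encodeUnary n).length = n + 1 := by simp [encodeUnary]

theorem length_le_length_encodeNumbers (ns : List ℕ) : ns.length ≤ (encodeNumbers ns).length := by
  induction ns with
  | nil => simp
  | cons n ns ih => simp [length_encodeUnary]; omega

/-- The entries of `ns` at the positions marked in `bs`. -/
def selected : List ℕ → List Bool → List ℕ
  | n :: ns, b :: bs => if b then n :: selected ns bs else selected ns bs
  | _, _ => []

theorem length_encodeNumbers_selected_le (ns : List ℕ) (bs : List Bool) :
    (encodeNumbers (selected ns bs)).length ≤ (encodeNumbers ns).length := by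
  induction ns generalizing bs with
  | nil => simp [selected]
  | cons n ns ih =>
    cases bs with
    | nil => simp [selected]
    | cons b bs =>
      have := ih bs
      cases b <;> simp [selected] <;> omega

theorem count_le_length_encodeNumbers (k : ℕ) (ns : List ℕ) :
    ns.count k ≤ (encodeNumbers ns).length :=
  List.count_le_length.trans (length_le_length_encodeNumbers ns)

/-- The contents of the stacks between two votes: `w` is the remaining input, `n` the number of
candidates, `k` the preferred candidate, `bs` the vector of scores, and `ns` lists the
candidates that have received a point. -/
def betweenVotes (n k : ℕ) (bs : List Bool) (w : List InputSymbol) (ns : List ℕ) : Store Reg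
  | .inp => w
  | .cands => ones n
  | .pref => ones k
  | .vec => bs.map .bit
  | .pts => encodeNumbers ns
  | _ => []

/-- The contents of the stacks after reading a vote that gives a point to the candidates `ms`. -/
def afterVote (n k : ℕ) (bs : List Bool) (w : List InputSymbol) (ns ms : List ℕ) : Store Reg :=
  Function.update (Function.update (betweenVotes n k bs w ns) .tmp (encodeNumbers ms).reverse)
    .flag (ones (ms.count k))

theorem update_afterVote (n k : ℕ) (bs : List Bool) (w w' : List InputSymbol) (ns ms : List ℕ) :
    Function.update (afterVote n k bs w ns ms) .inp w' = afterVote n k bs w' ns ms := by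
  funext i
  cases i <;> simp [afterVote, betweenVotes]

def isTrueBit : Option InputSymbol → Bool
  | some (.bit b) => b
  | _ => false

def isEndNumber : Option InputSymbol → Bool
  | some .endNumber => true
  | _ => false

def notEndVote : Option InputSymbol → Bool
  | some .endVote => false
  | _ => true

def notEndProfile : Option InputSymbol → Bool
  | some .endProfile => false
  | _ => true

namespace Program

open Function (update)

variable {M : FinTM2}

/-- Read a vote, collecting the candidates to whom it gives a point. -/
def scanVote : Program Reg M :=
  (whileTop .inp notEndVote
    ((ifTop .vec isTrueBit (compare .inp .tmp .pref .aux .exc .flag) (skipNumber .inp)).seq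
      (move .vec .vec'))).seq <|
  (pop .inp).seq (moveAll .vec' .vec)

/-- The score bits are consumed in parallel with the ranking and parked on `vec'`; the two reversals
cancel when they are moved back. -/
theorem runs_scanVote {n k : ℕ} {ms : List ℕ} {bs : List Bool} (h : ms.length = bs.length)
    (rest : List InputSymbol) (ns : List ℕ) :
    (scanVote : Program Reg M).Runs
      (betweenVotes n k bs (encodeNumbers ms ++ .endVote :: rest) ns)
      (afterVote n k bs rest ns (selected ms bs))
      (13 * (encodeNumbers ms).length + 3) := by
  have loop : ∀ (ms : List ℕ) (bs : List Bool) (S : Store Reg), ms.length = bs.length →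
      S .inp = encodeNumbers ms ++ .endVote :: rest → S .vec = bs.map .bit →
      S .pref = ones k → S .aux = [] → S .exc = [] →
      (whileTop .inp notEndVote
        ((ifTop .vec isTrueBit (compare .inp .tmp .pref .aux .exc .flag) (skipNumber .inp)).seq
          (move .vec .vec')) : Program Reg M).Runs S
        (update (update (update (update (update S .inp (.endVote :: rest))
          .tmp ((encodeNumbers (selected ms bs)).reverse ++ S .tmp))
          .flag (ones ((selected ms bs).count k) ++ S .flag)) .vec [])
          .vec' ((bs.map .bit).reverse ++ S .vec')) (11 * (encodeNumbers ms).length + 1) := by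
    intro ms
    induction ms with
    | nil =>
      intro bs S h hi hv hp ha he
      obtain rfl : bs = [] := by simpa using h.symm
      refine (runs_whileTop_false (by simp [hi, notEndVote])).congr ?_ (by simp)
      funext i
      cases i <;> simp_all [selected]
    | cons m ms ih =>
      intro bs S h hi hv hp ha he
      obtain _ | ⟨b, bs⟩ := bs
      · simp at h
      rw [encodeNumbers_cons, List.append_assoc] at hi
      -- An encoded number begins with a bit or, if it is zero, with its own end marker, never with
      -- `endVote`.
      have hn : notEndVote (S .inp).head? = true := by
        rw [hi]
        cases m <;> rfl
      cases b with
      | true =>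
        refine (runs_whileTop_true hn ((runs_ifTop_true (by simp [hv, isTrueBit])
          (runs_compare (by simp) hi hp ha he)).seq (runs_move (by simp) (x := .bit true)
            (w := bs.map .bit) (by simp [hv])))
          (ih bs _ (by simpa using h) (by simp) (by simp) (by simp [hp]) (by simp [ha])
            (by simp [he]))).congr ?_ ?_
        · funext i
          cases i <;> simp [selected, List.count_cons]
        · simp [length_encodeUnary]
          omega
      | false =>
        refine (runs_whileTop_true hn ((runs_ifTop_false (by simp [hv, isTrueBit])
          (runs_skipNumber (w := ones m) (rest := encodeNumbers ms ++ .endVote :: rest)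
            (by simp [ones, isBit]) (by simp [hi, encodeUnary_eq]))).seq
            (runs_move (by simp) (x := .bit false) (w := bs.map .bit) (by simp [hv])))
          (ih bs _ (by simpa using h) (by simp) (by simp) (by simp [hp]) (by simp [ha])
            (by simp [he]))).congr ?_ ?_
        · funext i
          cases i <;> simp [selected]
        · simp [length_encodeUnary]
          omega
  have := length_le_length_encodeNumbers ms
  refine ((loop ms bs _ h rfl rfl rfl rfl rfl).seq ((runs_pop _ _).seq
    (runs_moveAll (by simp) _))).congr ?_ ?_
  · funext i
    cases i <;> simp [afterVote, betweenVotes]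
  · simp [betweenVotes]
    omega

/-- Add the points given by the last vote. -/
def acceptVote : Program Reg M := (moveAll .tmp .pts).seq (clear .flag)

/-- Forget the last vote. -/
def rejectVote : Program Reg M := (clear .tmp).seq (clear .flag)

theorem runs_acceptVote (n k : ℕ) (bs : List Bool) (rest : List InputSymbol) (ms ns : List ℕ) :
    (acceptVote : Program Reg M).Runs
      (afterVote n k bs rest ns ms)
      (betweenVotes n k bs rest (ms ++ ns)) (4 * (encodeNumbers ms).length + 2) := by
  have := count_le_length_encodeNumbers k ms
  refine ((runs_moveAll (by simp) _).seq (runs_clear _ _)).congr ?_ (by simp [afterVote]; omega)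
  funext i
  cases i <;> simp [afterVote, betweenVotes]

theorem runs_rejectVote (n k : ℕ) (bs : List Bool) (rest : List InputSymbol) (ms ns : List ℕ) :
    (rejectVote : Program Reg M).Runs
      (afterVote n k bs rest ns ms)
      (betweenVotes n k bs rest ns) (4 * (encodeNumbers ms).length + 2) := by
  have := count_le_length_encodeNumbers k ms
  refine ((runs_clear _ _).seq (runs_clear _ _)).congr ?_ (by simp [afterVote]; omega)
  funext i
  cases i <;> simp [afterVote, betweenVotes]

/-- Add the points given by the last vote if the preferred candidate gets one of them. -/
def filterVote : Program Reg M := ifTop .flag Option.isSome acceptVote rejectVote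

theorem runs_filterVote (n k : ℕ) (bs : List Bool) (rest : List InputSymbol) (ms ns : List ℕ) :
    (filterVote : Program Reg M).Runs
      (afterVote n k bs rest ns ms)
      (betweenVotes n k bs rest ((if k ∈ ms then ms else []) ++ ns))
      (4 * (encodeNumbers ms).length + 3) := by
  by_cases h : k ∈ ms
  · refine (runs_ifTop_true (by simp [afterVote, List.count_eq_zero, h])
      (runs_acceptVote n k bs rest ms ns)).congr ?_ (by omega)
    simp [h]
  · refine (runs_ifTop_false (by simp [afterVote, List.count_eq_zero, h])
      (runs_rejectVote n k bs rest ms ns)).congr ?_ (by omega)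
    simp [h]

/-- Process the votes of a profile. -/
def forVotes (p : Program Reg M) : Program Reg M := (whileTop .inp notEndProfile p).seq (pop .inp)

theorem runs_forVotes {X : Type} {n k : ℕ} {bs : List Bool} {p : Program Reg M}
    {enc : X → List InputSymbol} {g : X → List ℕ} {C : ℕ}
    (henc : ∀ x, ∃ a w, enc x = a :: w ∧ a ≠ .endProfile)
    (hp : ∀ x rest ns, p.Runs (betweenVotes n k bs (enc x ++ rest) ns)
      (betweenVotes n k bs rest (g x ++ ns)) (C * (enc x).length))
    (xs : List X) (rest : List InputSymbol) (ns : List ℕ) :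
    (forVotes p).Runs (betweenVotes n k bs (xs.flatMap enc ++ .endProfile :: rest) ns)
      (betweenVotes n k bs rest (xs.foldl (fun ns x => g x ++ ns) ns))
      ((C + 1) * (xs.flatMap enc).length + 2) := by
  have loop : (whileTop .inp notEndProfile p).Runs
      (betweenVotes n k bs (xs.flatMap enc ++ .endProfile :: rest) ns)
      (betweenVotes n k bs (.endProfile :: rest) (xs.foldl (fun ns x => g x ++ ns) ns))
      ((C + 1) * (xs.flatMap enc).length + 1) := by
    induction xs generalizing ns with
    | nil => exact (runs_whileTop_false (by simp [betweenVotes, notEndProfile])).congr rfl (by simp)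
    | cons x xs ih =>
      obtain ⟨a, w, hx, ha⟩ := henc x
      rw [List.flatMap_cons, List.append_assoc]
      refine (runs_whileTop_true ?_ (hp x _ ns) (ih _)).congr rfl ?_
      · rw [hx]
        cases a <;> simp_all [betweenVotes, notEndProfile]
      -- Nonempty encodings let the `+ 1` in `C + 1` pay for the loop test.
      · have : 1 ≤ (enc x).length := by simp [hx]
        rw [List.length_append]
        nlinarith
  refine (loop.seq (runs_pop _ _)).congr ?_ le_rfl
  funext i
  cases i <;> simp [betweenVotes]

/-- Check whether no candidate has more points than the preferred one, and clean up. -/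
def decideWinner : Program Reg M :=
  (copy .cands .idx .pts').seq <|
  (whileTop .idx Option.isSome <|
    (pop .idx).seq <|
    (countEqual .pts .pts' .idx .aux .exc .sum).seq <|
    (countEqual .pts .pts' .pref .aux .exc .sum').seq <|
    (cancel .sum' .sum).seq <|
    (ifTop .sum Option.isSome (push .fail (.bit true)) skip).seq (clear .sum)).seq <|
  (clear .cands).seq <| (clear .pref).seq <| (clear .vec).seq <| (clear .pts).seq <|
  ifTop .fail Option.isSome (clear .fail) (push .res .endVote)

/-- The counter `idx` is popped before use, so it runs through `n - 1, …, 0`. A rival beats the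
preferred candidate iff the truncated difference of their multiplicities is positive, and `fail`
counts these rivals. -/
theorem runs_decideWinner (n k : ℕ) (bs : List Bool) (ns : List ℕ) :
    (decideWinner : Program Reg M).Runs (betweenVotes n k bs [] ns)
      (update (fun _ => []) .res
        (if ∀ i < n, ns.count i ≤ ns.count k then [.endVote] else []))
      (n * (27 * (encodeNumbers ns).length + 11) + 9 * n + 2 * k + 2 * bs.length
        + 2 * (encodeNumbers ns).length + 10) := by
  have loop : ∀ (n : ℕ) (S : Store Reg), S .idx = ones n → S .pts = encodeNumbers ns →
      S .pref = ones k → S .pts' = [] → S .aux = [] → S .exc = [] → S .sum = [] → S .sum' = [] →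
      (whileTop .idx Option.isSome <|
        (pop .idx).seq <|
        (countEqual .pts .pts' .idx .aux .exc .sum).seq <|
        (countEqual .pts .pts' .pref .aux .exc .sum').seq <|
        (cancel .sum' .sum).seq <|
        (ifTop .sum Option.isSome (push .fail (.bit true)) skip).seq (clear .sum) :
          Program Reg M).Runs S
        (update (update S .idx []) .fail
          (ones ((List.range n).countP fun i => ns.count k < ns.count i) ++ S .fail))
        (n * (27 * (encodeNumbers ns).length + 11) + 1) := by
    intro n
    induction n with
    | zero =>
      intro S hi hpt hp hp' ha he hs hs'
      refine (runs_whileTop_false (by simp [hi])).congr ?_ (by omega)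
      funext i
      cases i <;> simp [hi]
    | succ n ih =>
      intro S hi hpt hp hp' ha he hs hs'
      set f := if ns.count k < ns.count n then 1 else 0 with hf
      have check : ∀ S' : Store Reg, S' .sum = ones (ns.count n - ns.count k) →
          (ifTop .sum Option.isSome (push .fail (.bit true)) skip : Program Reg M).Runs S'
            (update S' .fail (ones f ++ S' .fail)) 2 := by
        intro S' h
        by_cases hlt : ns.count k < ns.count n
        · refine (runs_ifTop_true ?_ (runs_push _ _ _)).congr ?_ le_rfl
          · simp [h]; omega
          · simp [hf, hlt, ones_succ]
        · refine (runs_ifTop_false ?_ (runs_skip _)).congr ?_ le_rfl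
          · simp [h]; omega
          · simp [hf, hlt]
      refine (runs_whileTop_true (by simp [hi]) ((runs_pop _ _).seq <|
        (runs_countEqual (by simp) (ns := ns) (k := n) (by simp [hpt, encodeNumbers])
          (by simp [hp']) (by simp [hi]) (by simp [ha]) (by simp [he])).seq <|
        (runs_countEqual (by simp) (ns := ns) (k := k) (by simp [hpt, encodeNumbers])
          (by simp [hp']) (by simp [hp]) (by simp [ha]) (by simp [he])).seq <|
        (runs_cancel (by simp) (m := ns.count k) (n := ns.count n) (by simp [hs'])
          (by simp [hs])).seq <|
        (check _ (by simp)).seq (runs_clear _ _))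
        (ih _ (by simp [hi]) (by simp [hpt]) (by simp [hp]) (by simp [hp']) (by simp [ha])
          (by simp [he]) (by simp) (by simp))).congr ?_ ?_
      · funext i
        cases i <;> simp [hs, hs', List.range_succ, List.countP_cons, ← hf]
      · have h1 := count_le_length_encodeNumbers k ns
        have h2 := count_le_length_encodeNumbers n ns
        have h3 : (ns.flatMap encodeUnary).length = (encodeNumbers ns).length := rfl
        have h4 : (n + 1) * (27 * (encodeNumbers ns).length + 11) =
          n * (27 * (encodeNumbers ns).length + 11) + (27 * (encodeNumbers ns).length + 11) :=
          Nat.succ_mul _ _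
        simp [hs, -List.length_flatMap]
        omega
  have finish : ∀ (f : ℕ) (S : Store Reg), (∀ i, i ≠ .fail → S i = []) → S .fail = ones f →
      (ifTop .fail Option.isSome (clear .fail) (push .res .endVote) : Program Reg M).Runs S
        (update (fun _ => []) .res (if f = 0 then [.endVote] else [])) (2 * f + 2) := by
    intro f S hS hf
    by_cases h : f = 0
    · refine (runs_ifTop_false (by simp [hf, h]) (runs_push _ _ _)).congr ?_ (by omega)
      funext i
      cases i <;> simp [hS, hf, h]
    · refine (runs_ifTop_true (by simp [hf, h]) (runs_clear _ _)).congr ?_ (by simp [hf]; omega)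
      funext i
      cases i <;> simp [hS, h]
  have hfail : ((List.range n).countP fun i => ns.count k < ns.count i) ≤ n :=
    List.countP_le_length.trans (by simp)
  refine ((runs_copy (a := .cands) (b := .idx) (x := .pts') (by simp) (by simp) (by simp)
    (S := betweenVotes n k bs [] ns) (n := n) rfl rfl).seq <|
    (loop n (update (betweenVotes n k bs [] ns) .idx (ones n ++ [])) (by simp) rfl rfl rfl rfl rfl
      rfl rfl).seq <|
    (runs_clear _ _).seq <| (runs_clear _ _).seq <| (runs_clear _ _).seq <|
    (runs_clear _ _).seq (finish ((List.range n).countP fun i => ns.count k < ns.count i) _ ?_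
      (by simp [betweenVotes]))).congr ?_ ?_
  · intro i hi
    cases i <;> simp [betweenVotes] at hi ⊢
  · simp [List.countP_eq_zero]
  · simp [betweenVotes]
    omega

end Program

/-! ### Recognizing 0 and 1 from the first symbols of a binary number. -/

theorem encodeNat_eq_nil_iff (n : ℕ) : Computability.encodeNat n = [] ↔ n = 0 := by
  constructor
  · intro h
    rw [← Computability.decode_encodeNat n, h]
    rfl
  · rintro rfl
    rfl

/-- Among positive numbers only 1 has a single binary digit. The program uses this to detect
denominator 1 after popping one digit. -/
theorem tail_encodeNat_eq_nil_iff {n : ℕ} (hn : n ≠ 0) :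
    (Computability.encodeNat n).tail = [] ↔ n = 1 := by
  constructor
  · intro h
    rw [← Computability.decode_encodeNat n]
    unfold Computability.encodeNat at h ⊢
    rcases hp : (n : Num) with _ | p
    · exact absurd ((encodeNat_eq_nil_iff n).1 (by rw [Computability.encodeNat, hp]; rfl)) hn
    · rw [hp] at h
      cases p with
      | one => rfl
      | bit0 p => exact absurd h (Computability.encodePosNum_nonempty p)
      | bit1 p => exact absurd h (Computability.encodePosNum_nonempty p)
  · rintro rfl
    rfl

/-! ### Tabulating the scores and reading the voters. -/

namespace Program

open Function (update)

variable {M : FinTM2}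

/-- Read the number of candidates and the preferred candidate, and compute the scores. -/
def setup (e : M.Γ M.k₀ ≃ InputSymbol) : Program Reg M :=
  (readNumber .inp .cands).seq <| (readNumber .inp .pref).seq <|
  (copy .cands .idx .pts').seq <|
  whileTop .idx Option.isSome <|
    (pop .idx).seq <| (copy .cands .arg .pts').seq <| (push .arg .endNumber).seq <|
    (copy .idx .arg .pts').seq <| (push .arg .endNumber).seq (call e .arg .vec)

/-- The argument of each call is built bottom first, which gives the reversed order that `call`
expects. Positions are treated from `n - 1` down to `0`, so pushing the bits leaves them in
increasing order of position. -/
theorem runs_setup {e : M.Γ M.k₀ ≃ InputSymbol} {n k T : ℕ} {b : ℕ → Bool}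
    (h : ∀ j < n, ∃ u : List (M.Γ M.k₁), u.length ≤ 1 ∧ (!u.isEmpty) = b j ∧
      Nonempty (TM2OutputsInTime M ((encodeUnary n ++ encodeUnary j).map e.symm) (some u) T))
    (w : List InputSymbol) :
    (setup e).Runs (update (fun _ => []) .inp (encodeUnary n ++ encodeUnary k ++ w))
      (betweenVotes n k ((List.range n).map b) w []) (n * (12 * n + T + 20) + 7 * n + 2 * k + 7) := by
  have loop : ∀ (j : ℕ) (S : Store Reg), j ≤ n → S .cands = ones n → S .idx = ones j →
      S .arg = [] → S .pts' = [] →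
      (whileTop .idx Option.isSome <|
        (pop .idx).seq <| (copy .cands .arg .pts').seq <| (push .arg .endNumber).seq <|
        (copy .idx .arg .pts').seq <| (push .arg .endNumber).seq (call e .arg .vec)).Runs S
        (update (update S .idx []) .vec (((List.range j).map b).map .bit ++ S .vec))
        (j * (12 * n + T + 20) + 1) := by
    intro j
    induction j with
    | zero =>
      intro S _ hc hi ha hp
      refine (runs_whileTop_false (by simp [hi])).congr ?_ (by omega)
      funext i
      cases i <;> simp [hi]
    | succ j ih =>
      intro S hj hc hi ha hp
      obtain ⟨u, hu, hb, ⟨hM⟩⟩ := h j (by omega)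
      refine (runs_whileTop_true (by simp [hi]) ((runs_pop _ _).seq <|
        (runs_copy (by simp) (by simp) (by simp) (n := n) (by simp [hc]) (by simp [hp])).seq <|
        (runs_push _ _ _).seq <|
        (runs_copy (by simp) (by simp) (by simp) (n := j) (by simp [hi]) (by simp [hp])).seq <|
        (runs_push _ _ _).seq (runs_call ?_ hu hM))
        (ih _ (by omega) (by simp [hc]) (by simp [hi]) (by simp) (by simp [hp]))).congr ?_ ?_
      · simp [encodeUnary_eq, ha]
      · funext i
        cases i <;> simp [hb, ha, List.range_succ]
      · have : (j + 1) * (12 * n + T + 20) = j * (12 * n + T + 20) + (12 * n + T + 20) :=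
          Nat.succ_mul _ _
        simp only [List.length_append, length_encodeUnary]
        omega
  refine ((runs_readNumber (by simp) (n := n) (rest := encodeUnary k ++ w) (by simp)).seq <|
    (runs_readNumber (by simp) (n := k) (rest := w) (by simp)).seq <|
    (runs_copy (by simp) (by simp) (by simp) (n := n) (by simp) (by simp)).seq <|
    loop n _ le_rfl (by simp) (by simp) (by simp) (by simp)).congr ?_ (by omega)
  funext i
  cases i <;> simp [betweenVotes]

/-- Decide whether the preferred candidate wins, given a program that reads the voters. -/
def decideElection (e : M.Γ M.k₀ ≃ InputSymbol) (p : Program Reg M) : Program Reg M :=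
  (setup e).seq (p.seq decideWinner)

/-- Read the registered and the unregistered voters. -/
def readCCAUV : Program Reg M :=
  (forVotes (scanVote.seq acceptVote)).seq (forVotes (scanVote.seq filterVote))

/-- Read a voter with a probability of participating. -/
def readVoter : Program Reg M :=
  scanVote.seq <| ifTop .inp isEndNumber
    ((pop .inp).seq <| (skipNumber .inp).seq rejectVote)
    ((skipNumber .inp).seq <| (pop .inp).seq <| ifTop .inp isEndNumber
      ((pop .inp).seq acceptVote)
      ((skipNumber .inp).seq filterVote))

theorem runs_pop_afterVote (n k : ℕ) (bs : List Bool) (x : InputSymbol) (w : List InputSymbol)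
    (ns ms : List ℕ) :
    (pop .inp : Program Reg M).Runs (afterVote n k bs (x :: w) ns ms) (afterVote n k bs w ns ms) 1 :=
  (runs_pop _ _).congr (update_afterVote n k bs _ w ns ms) le_rfl

theorem runs_skipBinary_afterVote (n k : ℕ) (bs b : List Bool) (w : List InputSymbol)
    (ns ms : List ℕ) :
    (skipNumber .inp : Program Reg M).Runs
      (afterVote n k bs (b.map .bit ++ .endNumber :: w) ns ms) (afterVote n k bs w ns ms)
      (2 * b.length + 2) := by
  have hb : ∀ x ∈ b.map InputSymbol.bit, isBit (some x) = true := by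
    intro x hx
    obtain ⟨b, -, rfl⟩ := List.mem_map.1 hx
    rfl
  have := runs_skipNumber (M := M) (a := .inp) (rest := w)
    (S := afterVote n k bs (b.map .bit ++ .endNumber :: w) ns ms) hb rfl
  rwa [update_afterVote, List.length_map] at this

/-- An empty numerator means probability 0, and the vote is rejected. Otherwise one digit of the
denominator is removed, which exists as `den ≠ 0`. If nothing remains the denominator is 1 and the
vote is accepted outright; if not, it is kept only when it supports the preferred candidate. -/
theorem runs_readVoter {n k : ℕ} {ms : List ℕ} {bs : List Bool} (h : ms.length = bs.length)
    (num : ℕ) {den : ℕ} (hden : den ≠ 0) (rest : List InputSymbol) (ns : List ℕ) :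
    (readVoter : Program Reg M).Runs
      (betweenVotes n k bs (encodeNumbers ms ++ .endVote ::
        (encodeBinary num ++ (encodeBinary den ++ rest))) ns)
      (betweenVotes n k bs rest ((if num = 0 then [] else if den = 1 then selected ms bs else
        if k ∈ selected ms bs then selected ms bs else []) ++ ns))
      (17 * ((encodeNumbers ms).length + 1 + (encodeBinary num).length
        + (encodeBinary den).length)) := by
  have hl := length_encodeNumbers_selected_le ms bs
  refine ((runs_scanVote h _ _).seq (?_ : Runs _ _ _ ((encodeBinary num).length * 2 +
    (encodeBinary den).length * 2 + 4 * (encodeNumbers ms).length + 10))).congr rfl (by omega)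
  generalize selected ms bs = ms' at *
  have hd0 := (encodeNat_eq_nil_iff den).not.2 hden
  have hd1 := tail_encodeNat_eq_nil_iff hden
  have hn0 := encodeNat_eq_nil_iff num
  simp only [encodeBinary, List.append_assoc, List.singleton_append, List.length_append,
    List.length_map, List.length_singleton]
  generalize Computability.encodeNat num = a at *
  generalize Computability.encodeNat den = b at *
  obtain _ | ⟨d, b⟩ := b
  · exact absurd rfl hd0
  obtain _ | ⟨x, a⟩ := a
  · refine (runs_ifTop_true rfl ((runs_pop_afterVote _ _ _ _ _ _ _).seq
      ((runs_skipBinary_afterVote n k bs (d :: b) rest ns ms').seq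
        (runs_rejectVote n k bs rest ms' ns)))).congr ?_ ?_
    · simp [hn0.1 rfl]
    · simp
      omega
  have hn : num ≠ 0 := fun h => List.cons_ne_nil _ _ (hn0.2 h)
  refine (runs_ifTop_false rfl ((runs_skipBinary_afterVote n k bs (x :: a) _ ns ms').seq
    ((runs_pop_afterVote _ _ _ _ _ _ _).seq (?_ : Runs _ _ _ (2 * b.length + 4 *
      (encodeNumbers ms).length + 6))))).congr rfl (by simp; omega)
  rw [if_neg hn]
  obtain _ | ⟨y, b⟩ := b
  · rw [if_pos (hd1.1 rfl)]
    exact (runs_ifTop_true rfl ((runs_pop_afterVote _ _ _ _ _ _ _).seq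
      (runs_acceptVote n k bs rest ms' ns))).congr rfl (by simp; omega)
  · rw [if_neg fun h => List.cons_ne_nil _ _ (hd1.2 h)]
    exact (runs_ifTop_false rfl ((runs_skipBinary_afterVote n k bs (y :: b) rest ns ms').seq
      (runs_filterVote n k bs rest ms' ns))).congr rfl (by simp; omega)

end Program

/-! ### Polynomial time bounds -/

theorem Polynomial.eval_le_eval_of_le (p : Polynomial ℕ) {a b : ℕ} (h : a ≤ b) :
    p.eval a ≤ p.eval b := by
  rw [Polynomial.eval_eq_sum_range, Polynomial.eval_eq_sum_range]
  gcongr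

namespace PositionalScoringRule

/-- The positions that get a point among `n` candidates. -/
def scoreBits (r : PositionalScoringRule) (n : ℕ) : List Bool :=
  List.ofFn fun j : Fin n => decide (r.score n j = 1)

theorem scoreBits_eq (r : PositionalScoringRule) (n : ℕ) :
    r.scoreBits n = (List.range n).map fun j => if h : j < n then
      decide (r.score n ⟨j, h⟩ = 1) else false := by
  apply List.ext_getElem
  · simp [scoreBits]
  · intro i h h'
    have : i < n := by simpa [scoreBits] using h
    simp [scoreBits, this]

/-- In binary, 0 is the empty word and 1 a single symbol, so the output has length at most one and
its nonemptiness is the score. The time bound is stated in terms of `N` to be uniform over all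
positions. -/
theorem exists_output {r : PositionalScoringRule} (hb : r.IsBinary)
    (hr : TM2ComputableInPolyTime encodePosition Computability.encodeNat
      fun x : (m : ℕ) × Fin m => r.score x.1 x.2) {n j N : ℕ} (hj : j < n) (hN : n ≤ N) :
    ∃ u : List (hr.tm.Γ hr.tm.k₁), u.length ≤ 1 ∧
      (!u.isEmpty) = (if h : j < n then decide (r.score n ⟨j, h⟩ = 1) else false) ∧
      Nonempty (TM2OutputsInTime hr.tm
        ((encodeUnary n ++ encodeUnary j).map hr.inputAlphabet.symm) (some u)
        (hr.time.eval (2 * N + 2))) := by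
  have h := hr.outputsFun ⟨n, j, hj⟩
  have hlen : (encodePosition ⟨n, j, hj⟩).length ≤ 2 * N + 2 := by
    simp [encodePosition, length_encodeUnary]
    omega
  refine ⟨_, ?_, ?_, ⟨⟨h.toEvalsTo, h.steps_le_m.trans (hr.time.eval_le_eval_of_le hlen)⟩⟩⟩
  · rcases hb n ⟨j, hj⟩ with h | h <;> simp only [h]
    · exact Nat.zero_le _
    · exact le_rfl
  · rcases hb n ⟨j, hj⟩ with h | h <;> simp only [h, hj] <;> rfl

end PositionalScoringRule

open Program in
-- It suffices to supply a reader `p` that runs in linear time and leaves a list `ns` of points, no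
-- longer than the voters' part `w` of the input, whose multiplicities decide the question.
theorem polyTimeDecidable_of_reader {r : PositionalScoringRule} (hb : r.IsBinary)
    (hr : TM2ComputableInPolyTime encodePosition Computability.encodeNat
      fun x : (m : ℕ) × Fin m => r.score x.1 x.2)
    {α : Type} {enc : α → List InputSymbol} {P : α → Prop} (n k : α → ℕ)
    (w : α → List InputSymbol) (ns : α → List ℕ) (p : Program Reg hr.tm) (C : ℕ)
    (henc : ∀ a, enc a = encodeUnary (n a) ++ encodeUnary (k a) ++ w a)
    (hp : ∀ a, p.Runs (betweenVotes (n a) (k a) (r.scoreBits (n a)) (w a) [])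
      (betweenVotes (n a) (k a) (r.scoreBits (n a)) [] (ns a)) (C * (w a).length + C))
    (hlen : ∀ a, (encodeNumbers (ns a)).length ≤ (w a).length)
    (hP : ∀ a, (∀ i < n a, (ns a).count i ≤ (ns a).count (k a)) ↔ P a) :
    PolyTimeDecidable enc P := by
  refine ⟨fun a => decide (∀ i < n a, (ns a).count i ≤ (ns a).count (k a)),
    fun a => by simp [hP], ⟨?_⟩⟩
  have key (a : α) := outputs_toMachine (default := some false)
    (p := decideElection hr.inputAlphabet p) (i := .inp) (o := .res) (w := enc a)
    (b := decide (∀ i < n a, (ns a).count i ≤ (ns a).count (k a)))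
    -- The first term pays for one score computation per position, the quadratic term for preparing
    -- their arguments and for counting every candidate in the list of points, and the terms with
    -- `C` for the reader.
    (t := (enc a).length * hr.time.eval (2 * (enc a).length + 2) + 100 * (enc a).length ^ 2
      + (C + 100) * (enc a).length + C + 100) (by
    have hN : (enc a).length = n a + k a + 2 + (w a).length := by
      simp [henc, length_encodeUnary]
      omega
    have hs := runs_setup (e := hr.inputAlphabet) (n := n a) (k := k a)
      (fun j hj => r.exists_output hb hr hj (N := (enc a).length) (by omega)) (w a)
    rw [← r.scoreBits_eq, ← henc] at hs
    refine (hs.seq ((hp a).seq (runs_decideWinner _ _ _ _))).congr (by simp) ?_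
    have hl := hlen a
    have hbits : (r.scoreBits (n a)).length = n a := by simp [PositionalScoringRule.scoreBits]
    rw [hbits]
    generalize hr.time.eval (2 * (enc a).length + 2) = T
    generalize (encodeNumbers (ns a)).length = l at *
    generalize (enc a).length = N at *
    have h1 : n a * n a ≤ N * N := Nat.mul_le_mul (by omega) (by omega)
    have h2 : n a * l ≤ N * N := Nat.mul_le_mul (by omega) (by omega)
    have h3 : n a * T ≤ N * T := Nat.mul_le_mul_right _ (by omega)
    have h4 : C * (w a).length ≤ C * N := Nat.mul_le_mul_left _ (by omega)
    nlinarith)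
  exact
    { tm := (decideElection hr.inputAlphabet p).toMachine .inp .res (some false)
      inputAlphabet := Equiv.refl _
      outputAlphabet := Equiv.refl _
      time := Polynomial.X * hr.time.comp (2 * Polynomial.X + 2) + 100 * Polynomial.X ^ 2
        + (Polynomial.C C + 100) * Polynomial.X + Polynomial.C C + 100 + 1
      outputsFun := fun a => by
        have h := Classical.choice (key a)
        refine ⟨⟨h.steps, ?_⟩, h.steps_le_m.trans (by simp [Polynomial.eval_comp])⟩
        convert h.evals_in_steps using 4
        · exact congrArg _ (List.map_id _)
        · cases decide (∀ i < n a, (ns a).count i ≤ (ns a).count (k a)) <;> rfl }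

namespace PositionalScoringRule

variable {r : PositionalScoringRule} {m : ℕ}

/-! ### Optimality of adding the voters who support the candidate -/

theorem totalScore_append (r : PositionalScoringRule) (S T : Profile m) (c : Fin m) :
    r.totalScore (S ++ T) c = r.totalScore S c + r.totalScore T c := by
  simp [totalScore]

theorem totalScore_cons (r : PositionalScoringRule) (v : Ranking m) (T : Profile m) (c : Fin m) :
    r.totalScore (v :: T) c = r.contribution v c + r.totalScore T c := by
  simp [totalScore]

theorem IsBinary.contribution (hr : r.IsBinary) (v : Ranking m) (c : Fin m) :
    r.contribution v c = 0 ∨ r.contribution v c = 1 := hr m _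

/-- Replacing a sublist of `Q` by the supporters of `c` does not increase the lead of any other
candidate. -/
theorem IsBinary.totalScore_filter_le (hr : r.IsBinary) {Q' Q : Profile m} (h : Q'.Sublist Q)
    (c c' : Fin m) :
    r.totalScore (Q.filter fun v => r.contribution v c = 1) c' + r.totalScore Q' c ≤
      r.totalScore Q' c' + r.totalScore (Q.filter fun v => r.contribution v c = 1) c := by
  induction h with
  | slnil => simp [totalScore]
  | cons v h ih =>
    rcases hr.contribution v c with h0 | h1
    · simpa [h0] using ih
    -- A supporter missing from `Q'`: adding her gives `c` one point and `c'` at most one.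
    · rcases hr.contribution v c' with h | h <;> simp [h, h1, totalScore_cons] <;> omega
  | cons_cons v h ih =>
    rcases hr.contribution v c with h0 | h1
    -- A voter in `Q'` who does not support `c`: dropping her costs `c` nothing.
    · simp [h0, totalScore_cons]
      omega
    · simp [h1, totalScore_cons]
      omega

theorem IsBinary.exists_sublist_isWinner_iff (hr : r.IsBinary) (M Q : Profile m) (c : Fin m) :
    (∃ Q' : Profile m, Q'.Sublist Q ∧ r.IsWinner (M ++ Q') c) ↔
      r.IsWinner (M ++ Q.filter fun v => r.contribution v c = 1) c := by
  refine ⟨?_, fun h => ⟨_, List.filter_sublist, h⟩⟩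
  rintro ⟨Q', hQ', hw⟩ c'
  have h1 := hw c'
  have h2 := hr.totalScore_filter_le hQ' c c'
  rw [totalScore_append, totalScore_append] at h1 ⊢
  omega

/-! ### The lists of approved candidates -/

/-- The candidates that get a point from the voter `v`. -/
def approved (r : PositionalScoringRule) (v : Ranking m) : List ℕ :=
  selected (List.ofFn fun j => (v j : ℕ)) (r.scoreBits m)

theorem count_selected_ofFn (n : ℕ) (f : Fin n → ℕ) (b : Fin n → Bool) (x : ℕ) :
    (selected (List.ofFn f) (List.ofFn b)).count x =
      ∑ j, if f j = x ∧ b j = true then 1 else 0 := by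
  induction n with
  | zero => simp [selected]
  | succ n ih =>
    rw [List.ofFn_succ, List.ofFn_succ, Fin.sum_univ_succ, ← ih, selected]
    cases b 0 <;> simp [List.count_cons, add_comm]

/-- A ranking is a bijection, so `c` occurs only at position `v.symm c`, and the multiplicity is the
bit of that position. -/
theorem IsBinary.count_approved (hr : r.IsBinary) (v : Ranking m) (c : Fin m) :
    (r.approved v).count (c : ℕ) = r.contribution v c := by
  rw [approved, scoreBits, count_selected_ofFn, Finset.sum_eq_single (v.symm c)]
  · change (if v (v.symm c) = (c : ℕ) ∧ decide (r.contribution v c = 1) = true then 1 else 0) = _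
    rcases hr.contribution v c with h | h <;> simp [h]
  · intro j _ hj
    rw [if_neg]
    rintro ⟨h, -⟩
    exact hj (by rw [← Fin.ext h, Equiv.symm_apply_apply])
  · simp

theorem IsBinary.mem_approved (hr : r.IsBinary) (v : Ranking m) (c : Fin m) :
    (c : ℕ) ∈ r.approved v ↔ r.contribution v c = 1 := by
  rw [← List.count_pos_iff, hr.count_approved]
  rcases hr.contribution v c with h | h <;> simp [h]

end PositionalScoringRule

/-! ### Lists of points: multiplicities, length bounds, and the reader for CCAUV. -/

theorem encodeRanking_eq {m : ℕ} (v : Ranking m) :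
    encodeRanking v = encodeNumbers (List.ofFn fun j => (v j : ℕ)) ++ [.endVote] := by
  rw [encodeRanking, encodeNumbers, List.flatMap_def, List.map_ofFn]
  rfl

theorem exists_encodeRanking_eq_cons {m : ℕ} (v : Ranking m) :
    ∃ a w, encodeRanking v = a :: w ∧ a ≠ .endProfile := by
  rw [encodeRanking_eq]
  rcases List.ofFn fun j => (v j : ℕ) with _ | ⟨_ | n, ns⟩
  · exact ⟨_, _, rfl, by simp⟩
  · exact ⟨_, _, rfl, by simp⟩
  · exact ⟨_, _, rfl, by simp⟩

theorem count_foldl_append {X : Type} (g : X → List ℕ) (xs : List X) (ns : List ℕ) (i : ℕ) :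
    (xs.foldl (fun ns x => g x ++ ns) ns).count i =
      (xs.map fun x => (g x).count i).sum + ns.count i := by
  induction xs generalizing ns with
  | nil => simp
  | cons x xs ih =>
    rw [List.foldl_cons, ih, List.count_append, List.map_cons, List.sum_cons]
    omega

theorem length_encodeNumbers_foldl_append_le {X : Type} {g : X → List ℕ}
    {enc : X → List InputSymbol}
    (h : ∀ x, (encodeNumbers (g x)).length ≤ (enc x).length) (xs : List X) (ns : List ℕ) :
    (encodeNumbers (xs.foldl (fun ns x => g x ++ ns) ns)).length ≤
      (xs.flatMap enc).length + (encodeNumbers ns).length := by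
  induction xs generalizing ns with
  | nil => simp
  | cons x xs ih =>
    have h1 := ih (g x ++ ns)
    have h2 := h x
    simp only [List.foldl_cons, List.flatMap_cons, List.length_append, encodeNumbers_append] at h1 ⊢
    omega

theorem length_encodeNumbers_approved_le {m : ℕ} (r : PositionalScoringRule) (v : Ranking m) :
    (encodeNumbers (r.approved v)).length ≤ (encodeRanking v).length := by
  have := length_encodeNumbers_selected_le (List.ofFn fun j => (v j : ℕ)) (r.scoreBits m)
  rw [encodeRanking_eq, List.length_append]
  exact this.trans (Nat.le_add_right _ _)

namespace Program

variable {M : FinTM2} (r : PositionalScoringRule) {m : ℕ}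

theorem runs_scanRanking (k : ℕ) (v : Ranking m) (rest : List InputSymbol) (ns : List ℕ) :
    (scanVote : Program Reg M).Runs
      (betweenVotes m k (r.scoreBits m) (encodeRanking v ++ rest) ns)
      (afterVote m k (r.scoreBits m) rest ns (r.approved v))
      (13 * (encodeRanking v).length) := by
  have := runs_scanVote (M := M) (n := m) (k := k) (ms := List.ofFn fun j => (v j : ℕ))
    (bs := r.scoreBits m) (by simp [PositionalScoringRule.scoreBits]) rest ns
  rw [encodeRanking_eq, List.append_assoc]
  exact this.congr rfl (by simp; omega)

theorem runs_readCCAUV (k : ℕ) (P Q : Profile m) :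
    (readCCAUV : Program Reg M).Runs
      (betweenVotes m k (r.scoreBits m) (encodeProfile P ++ encodeProfile Q) [])
      (betweenVotes m k (r.scoreBits m) [] (Q.foldl
        (fun ns v => (if k ∈ r.approved v then r.approved v else []) ++ ns)
        (P.foldl (fun ns v => r.approved v ++ ns) [])))
      (21 * (encodeProfile P ++ encodeProfile Q).length) := by
  -- An encoded ranking has at least one symbol, so the additive constants fit into the factor 20.
  have h1 (v : Ranking m) (rest : List InputSymbol) (ns : List ℕ) :=
    (((runs_scanRanking (M := M) r k v rest ns).seq
      (runs_acceptVote m k (r.scoreBits m) rest (r.approved v) ns)).congr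
      (t' := 20 * (encodeRanking v).length) rfl (by
        have h1 := length_encodeNumbers_approved_le r v
        obtain ⟨a, w, h, -⟩ := exists_encodeRanking_eq_cons v
        have h2 : 1 ≤ (encodeRanking v).length := by simp [h]
        omega))
  have h2 (v : Ranking m) (rest : List InputSymbol) (ns : List ℕ) :=
    (((runs_scanRanking (M := M) r k v rest ns).seq
      (runs_filterVote m k (r.scoreBits m) rest (r.approved v) ns)).congr
      (t' := 20 * (encodeRanking v).length) rfl (by
        have h1 := length_encodeNumbers_approved_le r v
        obtain ⟨a, w, h, -⟩ := exists_encodeRanking_eq_cons v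
        have h2 : 1 ≤ (encodeRanking v).length := by simp [h]
        omega))
  have := (runs_forVotes exists_encodeRanking_eq_cons h1 P (encodeProfile Q) []).seq
    (runs_forVotes exists_encodeRanking_eq_cons h2 Q [] _)
  unfold encodeProfile at this ⊢
  rw [List.append_assoc, List.singleton_append]
  refine this.congr rfl ?_
  simp only [List.length_append, List.length_cons, List.length_nil]
  omega

end Program

/-! ### CCAUV in polynomial time. -/

namespace PositionalScoringRule

theorem IsBinary.polyTimeDecidable_CCAUV {r : PositionalScoringRule} (hb : r.IsBinary)
    (hr : r.PolyTimeComputable) : PolyTimeDecidable CCAUVInstance.encode fun I => CCAUV r I := by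
  obtain ⟨hr⟩ := hr
  refine polyTimeDecidable_of_reader hb hr (fun I => I.m) (fun I => I.c)
    (fun I => encodeProfile I.M ++ encodeProfile I.Q) _ Program.readCCAUV 21
    (fun I => by simp [CCAUVInstance.encode])
    (fun I => (Program.runs_readCCAUV r I.c I.M I.Q).congr rfl (Nat.le_add_right _ _))
    (fun I => ?_) fun I => ?_
  · refine (length_encodeNumbers_foldl_append_le (enc := encodeRanking) (fun v => ?_) _ _).trans ?_
    · split_ifs
      · exact length_encodeNumbers_approved_le r v
      · simp
    · have := length_encodeNumbers_foldl_append_le (length_encodeNumbers_approved_le (m := I.m) r)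
        I.M []
      simp only [encodeProfile, List.length_append, List.length_singleton, encodeNumbers_nil,
        List.length_nil] at this ⊢
      omega
  · rw [CCAUV, hb.exists_sublist_isWinner_iff]
    have hQ (Q : Profile I.m) (i : Fin I.m) : (Q.map fun v =>
        (if (I.c : ℕ) ∈ r.approved v then r.approved v else []).count (i : ℕ)).sum =
        r.totalScore (Q.filter fun v => r.contribution v I.c = 1) i := by
      induction Q with
      | nil => rfl
      | cons v Q ih =>
        rw [List.map_cons, List.sum_cons, ih]
        by_cases h : r.contribution v I.c = 1 <;>
          simp [h, totalScore_cons, hb.count_approved, hb.mem_approved]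
    -- Multiplicities in the list left by the reader are the scores in the election with all
    -- registered voters and the supporters among the unregistered ones.
    have key (i : Fin I.m) : (I.Q.foldl
        (fun ns v => (if (I.c : ℕ) ∈ r.approved v then r.approved v else []) ++ ns)
        (I.M.foldl (fun ns v => r.approved v ++ ns) [])).count (i : ℕ) =
        r.totalScore (I.M ++ I.Q.filter fun v => r.contribution v I.c = 1) i := by
      rw [count_foldl_append, count_foldl_append, hQ, totalScore_append, totalScore, totalScore,
        add_comm]
      simp [hb.count_approved]
    constructor
    · intro h c'
      rw [← key, ← key]
      exact h c' c'.2
    · intro h i hi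
      have := h ⟨i, hi⟩
      rwa [← key, ← key] at this

end PositionalScoringRule

/-! ### Positivity of the winning probability. -/

namespace WinInstance

variable (I : WinInstance)

theorem prob_nonneg (i : Fin I.n) : 0 ≤ I.prob i := (I.voters.get i).2.2.1

theorem prob_le_one (i : Fin I.n) : I.prob i ≤ 1 := (I.voters.get i).2.2.2

theorem probSubset_nonneg (U : Finset (Fin I.n)) : 0 ≤ I.probSubset U :=
  mul_nonneg (Finset.prod_nonneg fun i _ => I.prob_nonneg i)
    (Finset.prod_nonneg fun i _ => sub_nonneg.2 (I.prob_le_one i))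

/-- All factors are nonnegative, so the product is positive iff none vanishes: impossible voters
stay out and certain voters are in. -/
theorem probSubset_pos_iff (U : Finset (Fin I.n)) :
    0 < I.probSubset U ↔ (∀ i ∈ U, I.prob i ≠ 0) ∧ ∀ i ∉ U, I.prob i ≠ 1 := by
  rw [(I.probSubset_nonneg U).lt_iff_ne', probSubset, mul_ne_zero_iff, Finset.prod_ne_zero_iff,
    Finset.prod_ne_zero_iff]
  simp only [ne_eq, sub_eq_zero, Finset.mem_compl, eq_comm (a := (1 : ℚ))]

theorem winProb_pos_iff (r : PositionalScoringRule) :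
    0 < winProb r I ↔ ∃ U : Finset (Fin I.n), r.IsWinner (I.subprofile U) I.c ∧
      (∀ i ∈ U, I.prob i ≠ 0) ∧ ∀ i ∉ U, I.prob i ≠ 1 := by
  rw [winProb, Finset.sum_pos_iff_of_nonneg fun U _ => I.probSubset_nonneg U]
  simp [probSubset_pos_iff]

theorem totalScore_subprofile (r : PositionalScoringRule) (U : Finset (Fin I.n)) (c : Fin I.m) :
    r.totalScore (I.subprofile U) c = ∑ i ∈ U, r.contribution (I.voters.get i).1 c := by
  have h (l : List (Fin I.n)) :
      r.totalScore ((l.filter (· ∈ U)).map fun i => (I.voters.get i).1) c =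
        (l.map fun i => if i ∈ U then r.contribution (I.voters.get i).1 c else 0).sum := by
    induction l with
    | nil => rfl
    | cons i l ih =>
      by_cases hi : i ∈ U
      · rw [List.filter_cons_of_pos (by simpa using hi), List.map_cons,
          PositionalScoringRule.totalScore_cons, ih]
        simp [hi]
      · rw [List.filter_cons_of_neg (by simpa using hi), ih]
        simp [hi]
  rw [subprofile, h, ← Fin.sum_univ_def, Finset.sum_ite_mem, Finset.univ_inter]

/-- The voters who may participate, leaving out those whose participation is uncertain and who
do not support the preferred candidate. -/
def supporters (r : PositionalScoringRule) : Finset (Fin I.n) :=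
  {i | I.prob i ≠ 0 ∧ (I.prob i = 1 ∨ r.contribution (I.voters.get i).1 I.c = 1)}

theorem mem_supporters (r : PositionalScoringRule) (i : Fin I.n) : i ∈ I.supporters r ↔
    I.prob i ≠ 0 ∧ (I.prob i = 1 ∨ r.contribution (I.voters.get i).1 I.c = 1) := by
  simp [supporters]

theorem winProb_pos_iff_isWinner {r : PositionalScoringRule} (hr : r.IsBinary) :
    0 < winProb r I ↔ r.IsWinner (I.subprofile (I.supporters r)) I.c := by
  rw [winProb_pos_iff]
  constructor
  · rintro ⟨U, hw, h0, h1⟩ c'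
    have h := hw c'
    simp only [totalScore_subprofile] at h ⊢
    have key : ∑ i ∈ I.supporters r, r.contribution (I.voters.get i).1 c' +
        ∑ i ∈ U, r.contribution (I.voters.get i).1 I.c ≤
        ∑ i ∈ U, r.contribution (I.voters.get i).1 c' +
        ∑ i ∈ I.supporters r, r.contribution (I.voters.get i).1 I.c := by
      have hite (V : Finset (Fin I.n)) (f : Fin I.n → ℕ) :
          ∑ i ∈ V, f i = ∑ i, if i ∈ V then f i else 0 := by
        rw [Finset.sum_ite_mem, Finset.univ_inter]
      rw [hite (I.supporters r), hite U, hite U, hite (I.supporters r), ← Finset.sum_add_distrib,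
        ← Finset.sum_add_distrib]
      refine Finset.sum_le_sum fun i _ => ?_
      have hs := I.mem_supporters r i
      have hc := hr.contribution (I.voters.get i).1 I.c
      have hc' := hr.contribution (I.voters.get i).1 c'
      -- If only `U` contains the voter, her probability is nonzero, so she does not support `c`. If
      -- only `supporters` does, she is not certain, so she supports `c`. Either way the exchange
      -- does not help `c'` against `c`.
      by_cases hU : i ∈ U <;> by_cases hW : i ∈ I.supporters r <;>
        simp only [hU, hW, if_true, if_false]
      · omega
      · have : ¬r.contribution (I.voters.get i).1 I.c = 1 :=
          fun h => hW (hs.2 ⟨h0 i hU, .inr h⟩)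
        omega
      · have := (hs.1 hW).2.resolve_left (h1 i hU)
        omega
      · exact le_rfl
    omega
  · intro h
    refine ⟨_, h, fun i hi => ?_, fun i hi h1 => ?_⟩
    · exact (Finset.mem_filter.1 hi).2.1
    · exact hi (Finset.mem_filter.2 ⟨Finset.mem_univ i, by rw [h1]; exact one_ne_zero, .inl h1⟩)

end WinInstance

/-! ### Deciding positivity of the winning probability in polynomial time. -/

namespace PositionalScoringRule

open WinInstance

/-- The candidates who get a point from a voter, provided that the voter is a supporter of the
candidate `c`. -/
def approvedBySupporter (r : PositionalScoringRule) {m : ℕ} (c : ℕ)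
    (x : Ranking m × Set.Icc (0 : ℚ) 1) : List ℕ :=
  if (x.2 : ℚ).num.natAbs = 0 then [] else if (x.2 : ℚ).den = 1 then r.approved x.1 else
    if c ∈ r.approved x.1 then r.approved x.1 else []

/-- The only integer in the half-open interval (0, 1] is 1, so certain voters are recognized by
their denominator. -/
theorem _root_.Rat.den_eq_one_iff_of_mem_Icc {p : ℚ} (h0 : 0 ≤ p) (h1 : p ≤ 1) (hp : p ≠ 0) :
    p.den = 1 ↔ p = 1 := by
  constructor
  · intro h
    have hq : (p.num : ℚ) = p := (Rat.den_eq_one_iff p).1 h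
    have h2 : 0 < p.num := Rat.num_pos.2 (lt_of_le_of_ne h0 hp.symm)
    have h3 : p.num ≤ 1 := by
      rw [← hq] at h1
      exact_mod_cast h1
    rw [← hq, show p.num = 1 by omega]
    rfl
  · rintro rfl
    rfl

theorem IsBinary.count_approvedBySupporter {r : PositionalScoringRule} (hr : r.IsBinary)
    (I : WinInstance) (j : Fin I.n) (i : Fin I.m) :
    (r.approvedBySupporter I.c (I.voters.get j)).count (i : ℕ) =
      if j ∈ I.supporters r then r.contribution (I.voters.get j).1 i else 0 := by
  have h0 : ((I.voters.get j).2 : ℚ).num.natAbs = 0 ↔ I.prob j = 0 := by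
    rw [Int.natAbs_eq_zero, Rat.num_eq_zero]
    rfl
  by_cases hp : I.prob j = 0
  · rw [approvedBySupporter, if_pos (h0.2 hp), if_neg fun h => ((I.mem_supporters r j).1 h).1 hp,
      List.count_nil]
  have h1 : ((I.voters.get j).2 : ℚ).den = 1 ↔ I.prob j = 1 :=
    Rat.den_eq_one_iff_of_mem_Icc (I.prob_nonneg j) (I.prob_le_one j) hp
  rw [approvedBySupporter, if_neg (h0.not.2 hp), if_congr h1 rfl rfl,
    if_congr (hr.mem_approved _ _) rfl rfl, if_congr (I.mem_supporters r j) rfl rfl]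
  by_cases h : I.prob j = 1
  · rw [if_pos h, if_pos ⟨hp, .inl h⟩, hr.count_approved]
  by_cases h' : r.contribution (I.voters.get j).1 I.c = 1
  · rw [if_neg h, if_pos h', if_pos ⟨hp, .inr h'⟩, hr.count_approved]
  · rw [if_neg h, if_neg h', if_neg fun H => H.2.elim h h', List.count_nil]

theorem length_approvedBySupporter_le (r : PositionalScoringRule) {m : ℕ} (c : ℕ)
    (x : Ranking m × Set.Icc (0 : ℚ) 1) :
    (encodeNumbers (r.approvedBySupporter c x)).length ≤ (encodeVoter x).length := by
  have := length_encodeNumbers_approved_le r x.1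
  unfold approvedBySupporter encodeVoter
  rw [List.length_append, List.length_append]
  split_ifs <;> first | omega | exact Nat.zero_le _

theorem IsBinary.polyTimeDecidable_winProb_pos {r : PositionalScoringRule} (hb : r.IsBinary)
    (hr : r.PolyTimeComputable) :
    PolyTimeDecidable WinInstance.encode fun I => 0 < WinInstance.winProb r I := by
  obtain ⟨hr⟩ := hr
  refine polyTimeDecidable_of_reader hb hr (fun I => I.m) (fun I => I.c)
    (fun I => I.voters.flatMap encodeVoter ++ [.endProfile])
    (fun I => I.voters.foldl (fun ns x => r.approvedBySupporter I.c x ++ ns) [])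
    (Program.forVotes Program.readVoter) 18
    (fun I => by simp [WinInstance.encode]) (fun I => ?_) (fun I => ?_) fun I => ?_
  · refine (Program.runs_forVotes (enc := encodeVoter) (C := 17) (fun x => ?_)
      (fun x rest ns => ?_) I.voters [] []).congr rfl ?_
    · obtain ⟨a, w, h, ha⟩ := exists_encodeRanking_eq_cons x.1
      exact ⟨a, _, by rw [encodeVoter, h, List.append_assoc, List.cons_append], ha⟩
    · have := Program.runs_readVoter (M := hr.tm) (n := I.m) (k := I.c)
        (ms := List.ofFn fun j => (x.1 j : ℕ)) (bs := r.scoreBits I.m)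
        (by simp [scoreBits]) (x.2 : ℚ).num.natAbs (x.2 : ℚ).den_nz rest ns
      simp only [encodeVoter, encodeRanking_eq, List.append_assoc, List.singleton_append]
      refine this.congr rfl ?_
      simp only [List.length_append, List.length_cons]
      omega
    · simp only [List.length_append, List.length_singleton]
      omega
  · have := length_encodeNumbers_foldl_append_le
      (length_approvedBySupporter_le r (m := I.m) (I.c : ℕ)) I.voters []
    rw [List.length_append]
    exact this.trans (by simp)
  · have key (i : Fin I.m) :
        (I.voters.foldl (fun ns x => r.approvedBySupporter I.c x ++ ns) []).count (i : ℕ) =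
          r.totalScore (I.subprofile (I.supporters r)) i := by
      rw [count_foldl_append, totalScore_subprofile, List.count_nil, add_zero]
      -- Indexing the voters by their places turns the sum over the list into a sum over `Fin I.n`,
      -- which distinguishes voters with equal entries.
      conv_lhs => rw [← List.map_get_finRange I.voters]
      rw [List.map_map, ← Fin.sum_univ_def]
      simp only [Function.comp_apply, hb.count_approvedBySupporter]
      rw [Finset.sum_ite_mem, Finset.univ_inter]
    rw [I.winProb_pos_iff_isWinner hb]
    constructor
    · intro h c'
      rw [← key, ← key]
      exact h c' c'.2
    · intro h i hi
      have := h ⟨i, hi⟩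
      rwa [← key, ← key] at this

end PositionalScoringRule

/-! ### Approval and veto -/

namespace Program

open Function (update)

variable {M : FinTM2}

/-- Push `k` symbols on the stack `a`. -/
def pushConst (a : Reg) : ℕ → Program Reg M
  | 0 => skip
  | k + 1 => (push a (.bit true)).seq (pushConst a k)

theorem runs_pushConst (a : Reg) (k : ℕ) (S : Store Reg) :
    (pushConst a k : Program Reg M).Runs S (update S a (ones k ++ S a)) (k + 1) := by
  induction k generalizing S with
  | zero => exact (runs_skip S).congr (by simp) le_rfl
  | succ k ih =>
    exact ((runs_push a _ S).seq (ih _)).congr (by simp [ones_append_cons, ones_succ])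
      (by omega)

/-- Set the result to true if the counter `b` is larger than the counter `a`. -/
def decideLess (a b : Reg) : Program Reg M :=
  (cancel a b).seq (ifTop b Option.isSome ((clear b).seq (push .res .endVote)) skip)

/-- Cancelling leaves `n - m` on `b`, which is nonempty iff `m < n`. -/
theorem runs_decideLess {a b : Reg} (hab : a ≠ b) (hb : b ≠ .res) {S : Store Reg} {m n : ℕ}
    (hm : S a = ones m) (hn : S b = ones n) (h : ∀ i, i ≠ a → i ≠ b → S i = []) :
    (decideLess a b : Program Reg M).Runs S
      (update (fun _ => []) .res (if m < n then [.endVote] else [])) (3 * m + 2 * n + 5) := by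
  have hS : ∀ x, update (update S a []) b x = update (fun _ => []) b x := by
    intro x
    funext i
    by_cases hib : i = b
    · simp [hib]
    by_cases hia : i = a
    · simp [hia, hab]
    · simp [hia, hib, h]
  have hc := runs_cancel (M := M) hab hm hn
  rw [hS] at hc
  by_cases hlt : m < n
  · refine (hc.seq (runs_ifTop_true ?_ ((runs_clear _ _).seq (runs_push _ _ _)))).congr ?_ ?_
    · simp
      omega
    · simp [hlt, hb.symm]
    · simp
      omega
  · refine (hc.seq (runs_ifTop_false ?_ (runs_skip _))).congr ?_ (by omega)
    · simp
      omega
    · simp [hlt, Nat.sub_eq_zero_of_le (not_lt.1 hlt)]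

/-- Read two numbers, and compare the second one to `k`. -/
def approvalProgram (k : ℕ) : Program Reg M :=
  (readNumber .inp .cands).seq <| (clear .cands).seq <| (readNumber .inp .idx).seq <|
  (pushConst .sum k).seq (decideLess .idx .sum)

/-- Read two numbers, and compare the first one to the second one plus `k`. -/
def vetoProgram (k : ℕ) : Program Reg M :=
  (readNumber .inp .cands).seq <| (readNumber .inp .idx).seq <|
  (pushConst .idx k).seq (decideLess .idx .cands)

theorem runs_approvalProgram (k n j : ℕ) :
    (approvalProgram k : Program Reg M).Runs
      (update (fun _ => []) .inp (encodeUnary n ++ encodeUnary j))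
      (update (fun _ => []) .res (if j < k then [.endVote] else []))
      (5 * (n + j + 2) + 3 * k + 10) := by
  refine ((runs_readNumber (by simp) (n := n) (rest := encodeUnary j) (by simp)).seq <|
    (runs_clear _ _).seq <|
    (runs_readNumber (by simp) (n := j) (rest := []) (by simp)).seq <|
    (runs_pushConst _ k _).seq
      (runs_decideLess (by simp) (by simp) (m := j) (n := k) (by simp) (by simp) ?_)).congr rfl (by simp; omega)
  intro i _ _
  cases i <;> simp_all

theorem runs_vetoProgram (k n j : ℕ) :
    (vetoProgram k : Program Reg M).Runs
      (update (fun _ => []) .inp (encodeUnary n ++ encodeUnary j))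
      (update (fun _ => []) .res (if j + k < n then [.endVote] else []))
      (5 * (n + j + 2) + 4 * k + 10) := by
  refine ((runs_readNumber (by simp) (n := n) (rest := encodeUnary j) (by simp)).seq <|
    (runs_readNumber (by simp) (n := j) (rest := []) (by simp)).seq <|
    (runs_pushConst _ k _).seq
      (runs_decideLess (a := .idx) (b := .cands) (by simp) (by simp) (m := j + k) (n := n)
        (by simp [add_comm]) (by simp) ?_)).congr rfl (by omega)
  intro i _ _
  cases i <;> simp_all

end Program

/-- No subroutine is needed here, and `idComputer Unit` only fills its slot. With `default := none`
a negative answer is the empty word, which is the binary 0, and a positive one is `[true]`, the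
binary 1. -/
theorem PositionalScoringRule.polyTimeComputable_of_program {r : PositionalScoringRule}
    (p : Program Reg (idComputer Unit)) (b : (n : ℕ) → Fin n → Prop)
    [∀ n j, Decidable (b n j)] (hb : ∀ n j, r.score n j = if b n j then 1 else 0) (C : ℕ)
    (hp : ∀ n (j : Fin n), p.Runs
      (Function.update (fun _ => []) .inp (encodeUnary n ++ encodeUnary j))
      (Function.update (fun _ => []) .res (if b n j then [.endVote] else []))
      (5 * (n + j + 2) + C)) : r.PolyTimeComputable := by
  have key (x : (m : ℕ) × Fin m) := Program.outputs_toMachine (default := none) (p := p)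
    (i := .inp) (o := .res) (w := encodePosition x) (b := decide (b x.1 x.2))
    (t := 5 * (encodePosition x).length + C) (by
      refine (hp x.1 x.2).congr (by simp) ?_
      simp [encodePosition, length_encodeUnary]
      omega)
  exact ⟨
    { tm := p.toMachine .inp .res none
      inputAlphabet := Equiv.refl _
      outputAlphabet := Equiv.refl _
      time := 5 * Polynomial.X + Polynomial.C C + 1
      outputsFun := fun x => by
        have h := Classical.choice (key x)
        refine ⟨⟨h.steps, ?_⟩, h.steps_le_m.trans (by simp)⟩
        convert h.evals_in_steps using 4
        · exact congrArg _ (List.map_id _)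
        · rw [hb]
          by_cases h : b x.1 x.2 <;> simp only [h] <;> rfl }⟩

theorem kApproval_isBinary (k : ℕ) : (kApproval k).IsBinary := fun m j => by
  by_cases h : (j : ℕ) < k <;> simp [kApproval, h]

theorem kVeto_isBinary (k : ℕ) : (kVeto k).IsBinary := fun m j => by
  by_cases h : (j : ℕ) + k < m <;> simp [kVeto, h]

theorem kApproval_polyTimeComputable (k : ℕ) : (kApproval k).PolyTimeComputable :=
  PositionalScoringRule.polyTimeComputable_of_program (Program.approvalProgram k)
    (fun _ j => (j : ℕ) < k) (fun _ _ => rfl) (3 * k + 10)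
    fun n j => Program.runs_approvalProgram k n j

theorem kVeto_polyTimeComputable (k : ℕ) : (kVeto k).PolyTimeComputable :=
  PositionalScoringRule.polyTimeComputable_of_program (Program.vetoProgram k)
    (fun n j => (j : ℕ) + k < n) (fun _ _ => rfl) (4 * k + 10)
    fun n j => Program.runs_vetoProgram k n j

theorem mainTheorem12 :
    -- CCAUV and nonzeroness of the winning probability are decidable in polynomial time
    (∀ r : PositionalScoringRule, r.IsBinary → r.PolyTimeComputable →
      PolyTimeDecidable CCAUVInstance.encode (fun I => CCAUV r I) ∧
      PolyTimeDecidable WinInstance.encode (fun I => 0 < WinInstance.winProb r I)) ∧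
    -- this covers `k`-approval and `k`-veto
    (∀ k : ℕ, (kApproval k).IsBinary ∧ (kApproval k).PolyTimeComputable ∧
      (kVeto k).IsBinary ∧ (kVeto k).PolyTimeComputable) ∧
    -- adding exactly the voters who give `c` a point is optimal
    (∀ r : PositionalScoringRule, r.IsBinary →
      ∀ (m : ℕ) (M Q : Profile m) (c : Fin m),
        (∃ Q' : Profile m, Q'.Sublist Q ∧ r.IsWinner (M ++ Q') c) ↔
          r.IsWinner (M ++ Q.filter (fun v => r.contribution v c = 1)) c) :=
  ⟨fun _ hb hr => ⟨hb.polyTimeDecidable_CCAUV hr, hb.polyTimeDecidable_winProb_pos hr⟩,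
    fun k => ⟨kApproval_isBinary k, kApproval_polyTimeComputable k, kVeto_isBinary k,
      kVeto_polyTimeComputable k⟩,
    fun _ hb _ M Q c => hb.exists_sublist_isWinner_iff M Q c⟩
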